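/- Let $(X,d,\mu)$ be a metric measure space, i.e. $d$ is a complete separable length metric on $X$ and $\mu$ is a locally finite Borel measure on $X$ with full support. Let $n\ge 2$ be an integer and $\kappa\ge 0$ a real number; $B_r(x)$ denotes the closed $r$-ball. Assume: (1) ($n$-dimensional condition) $\displaystyle\lim_{r\to 0^+}\frac{\mu(B_r(x))}{\mathrm{vol}(B_r(\mathbf R^n))}=1$ for every $x\in X$, where $B_r(\mathbf R^n)$ is the closed $r$-ball of Euclidean $\mathbf R^n$. (2) (curvature-dimension condition $\mathrm{CD}(\kappa,n)$ in the sense of Sturm) Let $P_2(X,d,\mu)$ be the set of $\mu$-absolutely continuous Borel probability measures on $X$ with finite second moment, with the $L^2$-Wasserstein distance. For all $\nu_0=\rho_0\mu$ and $\nu_1=\rho_1\mu$ in $P_2(X,d,\mu)$ there are an optimal coupling $q$ of $\nu_0,\nu_1$ (for the cost $d^2$) and a constant speed minimal geodesic $(\nu_t)_{t\in[0,1]}$, $\nu_t=\rho_t\mu$, in $P_2(X,d,\mu)$ from $\nu_0$ to $\nu_1$ such that for all $t\in[0,1]$ and all real $N'\ge n$ $$-\int_X\rho_t^{-1/N'}\,d\nu_t\le-\int_{X\times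 X}\Big[\tau^{(1-t)}_{\kappa,N'}(d(x_0,x_1))\,\rho_0(x_0)^{-1/N'}+\tau^{(t)}_{\kappa,N'}(d(x_0,x_1))\,\rho_1(x_1)^{-1/N'}\Big]dq(x_0,x_1),$$ where $\tau^{(t)}_{\kappa,N'}(\theta)=t$ if $\kappa\theta^2=0$, $\tau^{(t)}_{\kappa,N'}(\theta)=t^{1/N'}\Big(\frac{\sin(t\theta\sqrt{\kappa/(N'-1)})}{\sin(\theta\sqrt{\kappa/(N'-1)})}\Big)^{1-1/N'}$ if $0<\kappa\theta^2<(N'-1)\pi^2$, and $\tau^{(t)}_{\kappa,N'}(\theta)=\infty$ if $\kappa\theta^2\ge(N'-1)\pi^2>0$. Then the $n$-volumic scalar curvature of $X$ satisfies $\mathrm{Sc}^{\mathrm{vol}_n}(X)\ge n\kappa$. That is: - if $\kappa=0$, there is $r>0$ such that $\mu(B_\epsilon(x))\le\mathrm{vol}(B_\epsilon(\mathbf R^n))$ for all $x\in X$ and $0<\epsilon\le r$; - if $\kappa>0$, then for every $\gamma>\sqrt{2/(n\kappa)}$ there is $r>0$ such that $\mu(B_\epsilon(x))<\mathrm{vol}(B_\epsilon(y))$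 for all $x\in X$, all $y\in S^2(\gamma)\times\mathbf R^{n-2}$ and all $0<\epsilon\le r$, where $S^2(\gamma)$ is the round $2$-sphere of radius $\gamma$ with its geodesic distance $d_S$ and area measure, and $S^2(\gamma)\times\mathbf R^{n-2}$ carries the distance $\sqrt{d_S^2+d_E^2}$, with $d_E$ the Euclidean distance, and the product measure. -/

import Mathlib

open MeasureTheory Filter Topology Set
open scoped ENNReal

noncomputable section

namespace VolumicScalar

/-- `d` is a length metric: the distance of any two points is the infimum of the lengths of the
continuous curves that join them. -/
def IsLengthMetric (X : Type*) [MetricSpace X] : Prop :=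
  ∀ x y : X, edist x y = ⨅ γ : Path x y, eVariationOn (fun t => γ t) univ

/-! ### The `L²`-Wasserstein space -/

section Wasserstein

variable {X : Type*} [MetricSpace X] [MeasurableSpace X]

/-- `q` is a coupling of `ν₀` and `ν₁`. -/
def IsCoupling (q : Measure (X × X)) (ν₀ ν₁ : Measure X) : Prop :=
  q.map Prod.fst = ν₀ ∧ q.map Prod.snd = ν₁

/-- The quadratic cost `∫ d(x₀, x₁)² dq(x₀, x₁)` of a transport plan. -/
def cost (q : Measure (X × X)) : ℝ≥0∞ :=
  ∫⁻ p, edist p.1 p.2 ^ 2 ∂q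

/-- The `L²`-Wasserstein distance. -/
def W2 (ν₀ ν₁ : Measure X) : ℝ≥0∞ :=
  (⨅ q : {q : Measure (X × X) // IsCoupling q ν₀ ν₁}, cost q.1) ^ (1 / 2 : ℝ)

/-- `q` is an optimal coupling of `ν₀` and `ν₁` for the quadratic cost. -/
def IsOptimalCoupling (q : Measure (X × X)) (ν₀ ν₁ : Measure X) : Prop :=
  IsCoupling q ν₀ ν₁ ∧ ∀ q' : Measure (X × X), IsCoupling q' ν₀ ν₁ → cost q ≤ cost q'

/-- `ν ∈ P₂(X, d, μ)`: a probability measure with finite second moment that is absolutely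
continuous with respect to `μ`. -/
def MemP2 (μ ν : Measure X) : Prop :=
  IsProbabilityMeasure ν ∧ (∃ o : X, ∫⁻ x, edist o x ^ 2 ∂ν < ∞) ∧ ν ≪ μ

/-- `Γ`, restricted to `[0, 1]`, is a constant speed minimal geodesic from `ν₀` to `ν₁` in
`P₂(X, d, μ)` with the Wasserstein distance. -/
def IsW2Geodesic (μ : Measure X) (Γ : ℝ → Measure X) (ν₀ ν₁ : Measure X) : Prop :=
  Γ 0 = ν₀ ∧ Γ 1 = ν₁ ∧ (∀ t ∈ Icc (0 : ℝ) 1, MemP2 μ (Γ t)) ∧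
    ∀ s ∈ Icc (0 : ℝ) 1, ∀ t ∈ Icc (0 : ℝ) 1,
      W2 (Γ s) (Γ t) = ENNReal.ofReal |s - t| * W2 ν₀ ν₁

end Wasserstein

/-! ### The curvature-dimension condition -/

/-- The volume distortion coefficient `τ_{K,N}^{(t)}(θ)`, for `N ≥ 1`, `t ∈ [0, 1]`, `θ ≥ 0`. -/
def tau (K N t θ : ℝ) : ℝ≥0∞ :=
  if K * θ ^ 2 = 0 then ENNReal.ofReal t
  else if 0 < K * θ ^ 2 then
    if (N - 1) * Real.pi ^ 2 ≤ K * θ ^ 2 then ∞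
    else ENNReal.ofReal (t ^ (1 / N) *
      (Real.sin (t * θ * √(K / (N - 1))) / Real.sin (θ * √(K / (N - 1)))) ^ (1 - 1 / N))
  else if N = 1 then ENNReal.ofReal t
  else ENNReal.ofReal (t ^ (1 / N) *
      (Real.sinh (t * θ * √(-K / (N - 1))) / Real.sinh (θ * √(-K / (N - 1)))) ^ (1 - 1 / N))

/-- The quantity `∫ ρ^{-1/N} dν` with `ρ = dν/dμ`, for `ν` absolutely continuous with respect to
`μ`. It is minus the Rényi entropy `S_N(ν | μ)`. -/
def negRenyi {X : Type*} [MeasurableSpace X] (N : ℝ) (ν μ : Measure X) : ℝ≥0∞ :=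
  ∫⁻ x, (ν.rnDeriv μ x) ^ (-1 / N) ∂ν

/-- The curvature-dimension condition `CD(K, N)` (Sturm). Both sides of the entropy inequality
are multiplied by `-1`, so that they are integrals of nonnegative functions. -/
def CD {X : Type*} [MetricSpace X] [MeasurableSpace X] (K N : ℝ) (μ : Measure X) : Prop :=
  ∀ ν₀ ν₁ : Measure X, MemP2 μ ν₀ → MemP2 μ ν₁ →
    ∃ (q : Measure (X × X)) (Γ : ℝ → Measure X),
      IsOptimalCoupling q ν₀ ν₁ ∧ IsW2Geodesic μ Γ ν₀ ν₁ ∧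
      ∀ t ∈ Icc (0 : ℝ) 1, ∀ N' : ℝ, N ≤ N' →
        ∫⁻ p, (tau K N' (1 - t) (dist p.1 p.2) * (ν₀.rnDeriv μ p.1) ^ (-1 / N') +
            tau K N' t (dist p.1 p.2) * (ν₁.rnDeriv μ p.2) ^ (-1 / N')) ∂q
          ≤ negRenyi N' (Γ t) μ

/-! ### Volumes of balls in the model spaces -/

/-- The volume of the closed `r`-ball in the Euclidean space `ℝⁿ`. -/
def euclideanBallVol (n : ℕ) (r : ℝ) : ℝ≥0∞ :=
  volume (Metric.closedBall (0 : EuclideanSpace ℝ (Fin n)) r)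

/-- The underlying set of the round sphere `S²(γ)`: its points are represented by their directions,
i.e. by points of the unit sphere of `ℝ³`. -/
abbrev S2 : Type := Metric.sphere (0 : EuclideanSpace ℝ (Fin 3)) 1

/-- The geodesic distance of the round sphere of radius `γ`. -/
def distS (γ : ℝ) (x y : S2) : ℝ :=
  γ * InnerProductGeometry.angle (x : EuclideanSpace ℝ (Fin 3)) (y : EuclideanSpace ℝ (Fin 3))

/-- The area measure of the round sphere of radius `γ`. -/
def volS (γ : ℝ) : Measure S2 :=
  ENNReal.ofReal (γ ^ 2) • (volume : Measure (EuclideanSpace ℝ (Fin 3))).toSphere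

/-- The Pythagorean product distance of `S²(γ) × ℝᵐ`. -/
def distSE (γ : ℝ) {m : ℕ} (p q : S2 × EuclideanSpace ℝ (Fin m)) : ℝ :=
  √(distS γ p.1 q.1 ^ 2 + dist p.2 q.2 ^ 2)

/-- The product volume of `S²(γ) × ℝᵐ`. -/
def volSE (γ : ℝ) (m : ℕ) : Measure (S2 × EuclideanSpace ℝ (Fin m)) :=
  (volS γ).prod volume

/-- The closed `r`-ball with centre `y` in `S²(γ) × ℝᵐ`. -/
def ballSE (γ : ℝ) {m : ℕ} (y : S2 × EuclideanSpace ℝ (Fin m)) (r : ℝ) :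
    Set (S2 × EuclideanSpace ℝ (Fin m)) :=
  {p | distSE γ p y ≤ r}

/-! ### The `n`-dimensional condition and the `n`-volumic scalar curvature -/

section Volumic

variable {X : Type*} [MetricSpace X] [MeasurableSpace X]

/-- The `n`-dimensional condition. -/
def NDimensional (n : ℕ) (μ : Measure X) : Prop :=
  ∀ x : X, Tendsto (fun r : ℝ => μ (Metric.closedBall x r) / euclideanBallVol n r)
    (𝓝[>] 0) (𝓝 1)

/-- `Sc^{vol_n}(X) ≥ 0`: all sufficiently small balls (uniformly in the centre) have measure at
most that of Euclidean balls of the same radius. -/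
def VolScalNonneg (n : ℕ) (μ : Measure X) : Prop :=
  ∃ r : ℝ, 0 < r ∧ ∀ ε : ℝ, 0 < ε → ε ≤ r → ∀ x : X,
    μ (Metric.closedBall x ε) ≤ euclideanBallVol n ε

/-- `Sc^{vol_n}(X) ≥ κ` for `κ > 0` and `n ≥ 2`: for every `γ > √(2/κ)`, all sufficiently small
balls (uniformly in the centre) have measure smaller than the balls of the same radius in
`S²(γ) × ℝⁿ⁻²`. -/
def VolScalGEPos (n : ℕ) (κ : ℝ) (μ : Measure X) : Prop :=
  ∀ γ : ℝ, √(2 / κ) < γ → ∃ r : ℝ, 0 < r ∧ ∀ ε : ℝ, 0 < ε → ε ≤ r →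
    ∀ (x : X) (y : S2 × EuclideanSpace ℝ (Fin (n - 2))),
      μ (Metric.closedBall x ε) < volSE γ (n - 2) (ballSE γ y ε)

/-- `Sc^{vol_n}(X) ≥ κ`, a notion defined for `κ ≥ 0`. -/
def VolScalGE (n : ℕ) (κ : ℝ) (μ : Measure X) : Prop :=
  (κ = 0 ∧ VolScalNonneg n μ) ∨ (0 < κ ∧ VolScalGEPos n κ μ)

end Volumic

end VolumicScalar

end

open MeasureTheory Filter Topology Set
open scoped ENNReal

noncomputable section

namespace VolumicScalar

/-! ### Elementary trigonometric bounds -/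

/-! The proof is a Bishop inequality sharp to second order in the radius, compared with a
second-order expansion of ball volumes in `S²(γ) × ℝⁿ⁻²`.

Transport the normalised measure of a tiny ball `B_ε(x)` to a probability measure on `A ⊆ B_R(x)`
whose density is proportional to `h = 1 + κ d(·, x)² / 6`. The intermediate measure at time `t`
lives in `B_{tR+3ε}(x)` (`intermediate_measure_compl_closedBall`), so Hölder bounds its entropy by
the measure of that ball (`negRenyi_le`). The coefficient `τ^{(t)}` satisfies `τⁿ ≥ tⁿ h` up to
factors tending to `1` (`tau_pow_ge_of_dist`), and the weight `h` cancels exactly this dependence on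
the endpoint. Hence `tⁿ ∫_A h dμ ≤ μ(B_{tR+3ε}(x))` up to such factors. With `ε = t²` and `t → 0`,
the `n`-dimensional condition turns the right side into a Euclidean volume: `∫_{B_R(x)} h dμ ≤ ω_n
Rⁿ`, where `ω_n` is the volume of the Euclidean unit ball.

Since `h ≥ 1`, this settles `κ = 0`. For `κ > 0`, the resulting bound on all concentric balls gives,
by the layer cake formula, `∫ (R² - d²)⁺ dμ ≤ 2R²/(n+2) · ω_n Rⁿ`. Adding `κ/6` times this makes the
weight constant on the ball, so the ratio of `μ(B_R(x))` to the Euclidean volume is at most `1 -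
nκR²/(6(n+2)) + O(R⁴)`, uniformly in `x`. In the model the ratio is at least `1 - 2γ⁻²R²/(6(n+2))`
(`volSE_ballSE_ge_mul`), and `nκ > 2/γ²` separates the two. -/

theorem nonneg_of_hasDerivAt_nonneg {f f' : ℝ → ℝ} (hf : ∀ x, HasDerivAt f (f' x) x)
    (h0 : f 0 = 0) (hf' : ∀ x, 0 ≤ x → 0 ≤ f' x) {x : ℝ} (hx : 0 ≤ x) : 0 ≤ f x := by
  have hm : MonotoneOn f (Ici 0) := by
    apply monotoneOn_of_deriv_nonneg (convex_Ici 0)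
    · exact fun y _ => (hf y).continuousAt.continuousWithinAt
    · exact fun y _ => (hf y).differentiableAt.differentiableWithinAt
    · intro y hy
      rw [interior_Ici] at hy
      rw [(hf y).deriv]
      exact hf' y (le_of_lt hy)
  simpa [h0] using hm (mem_Ici.2 le_rfl) (mem_Ici.2 hx) hx

theorem cos_le_quartic {x : ℝ} (hx : 0 ≤ x) : Real.cos x ≤ 1 - x ^ 2 / 2 + x ^ 4 / 24 := by
  have h := nonneg_of_hasDerivAt_nonneg (f := fun x => 1 - x ^ 2 / 2 + x ^ 4 / 24 - Real.cos x)
    (f' := fun x => Real.sin x - (x - x ^ 3 / 6)) (fun x => by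
      have := ((((hasDerivAt_pow 2 x).div_const 2).const_sub 1).add
        ((hasDerivAt_pow 4 x).div_const 24)).sub (Real.hasDerivAt_cos x)
      exact this.congr_deriv (by push_cast; ring)) (by simp)
      (fun x hx => sub_nonneg.2 (Real.sin_ge_sub_cube hx)) hx
  linarith

theorem sin_le_quintic {x : ℝ} (hx : 0 ≤ x) : Real.sin x ≤ x - x ^ 3 / 6 + x ^ 5 / 120 := by
  have h := nonneg_of_hasDerivAt_nonneg (f := fun x => x - x ^ 3 / 6 + x ^ 5 / 120 - Real.sin x)
    (f' := fun x => 1 - x ^ 2 / 2 + x ^ 4 / 24 - Real.cos x) (fun x => by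
      have := (((hasDerivAt_id x).sub ((hasDerivAt_pow 3 x).div_const 6)).add
        ((hasDerivAt_pow 5 x).div_const 120)).sub (Real.hasDerivAt_sin x)
      exact this.congr_deriv (by push_cast; ring)) (by simp)
      (fun x hx => sub_nonneg.2 (cos_le_quartic hx)) hx
  linarith

theorem pi_sq_lt_twelve : Real.pi ^ 2 < 12 := by
  have h1 := Real.pi_lt_d2
  have h2 := Real.pi_pos
  nlinarith

/-- The quintic Taylor bound leaves the defect `x⁵ (14 - x²) / 720`, which is nonnegative because
`π² < 12`. Having the bound on all of `[0, π]` spares any restriction to small distances. -/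
theorem sin_mul_one_add_le {x : ℝ} (hx : 0 ≤ x) (hx' : x ≤ Real.pi) :
    Real.sin x * (1 + x ^ 2 / 6) ≤ x := by
  have h1 := sin_le_quintic hx
  have h2 : x ^ 2 ≤ 12 := (pow_le_pow_left₀ hx hx' 2).trans pi_sq_lt_twelve.le
  have h3 : 0 ≤ x ^ 5 * (14 - x ^ 2) := mul_nonneg (by positivity) (by linarith)
  calc Real.sin x * (1 + x ^ 2 / 6) ≤ (x - x ^ 3 / 6 + x ^ 5 / 120) * (1 + x ^ 2 / 6) := by gcongr
    _ ≤ x := by linarith [show (x - x ^ 3 / 6 + x ^ 5 / 120) * (1 + x ^ 2 / 6)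
          = x - x ^ 5 * (14 - x ^ 2) / 720 by ring]

/-- The quotient `sin (t φ) / sin φ` compared with its Taylor expansion at `φ = 0`. -/
theorem sin_mul_div_sin_ge {t φ : ℝ} (ht : 0 ≤ t) (ht' : 2 * t ^ 2 ≤ 1) (hφ : 0 < φ)
    (hφ' : φ < Real.pi) :
    t * (1 - 2 * t ^ 2) * (1 + φ ^ 2 / 6) ≤ Real.sin (t * φ) / Real.sin φ := by
  have hs : 0 < Real.sin φ := Real.sin_pos_of_pos_of_lt_pi hφ hφ'
  rw [le_div_iff₀ hs]
  have h1 := Real.sin_ge_sub_cube (mul_nonneg ht hφ.le)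
  have h2 := sin_mul_one_add_le hφ.le hφ'.le
  have h3 : φ ^ 2 ≤ 12 := (pow_le_pow_left₀ hφ.le hφ'.le 2).trans pi_sq_lt_twelve.le
  have h4 : t * (1 - 2 * t ^ 2) * φ ≤ Real.sin (t * φ) := by
    refine le_trans ?_ h1
    have : 0 ≤ t ^ 3 * φ * (12 - φ ^ 2) := mul_nonneg (by positivity) (by linarith)
    linarith [show t * φ - (t * φ) ^ 3 / 6 - t * (1 - 2 * t ^ 2) * φ
      = t ^ 3 * φ * (12 - φ ^ 2) / 6 by ring]
  calc t * (1 - 2 * t ^ 2) * (1 + φ ^ 2 / 6) * Real.sin φ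
      = t * (1 - 2 * t ^ 2) * (Real.sin φ * (1 + φ ^ 2 / 6)) := by ring
    _ ≤ t * (1 - 2 * t ^ 2) * φ :=
        mul_le_mul_of_nonneg_left h2 (mul_nonneg ht (by linarith))
    _ ≤ _ := h4

/-! ### A lower bound for the distortion coefficient -/

/-- The `n`-th power of `τ` is `t` times the `(n-1)`-st power of the sine quotient at `φ = θ
√(κ/(n-1))`. Bernoulli's inequality turns the `n - 1` factors `1 + φ²/6` into `1 + κθ²/6`. -/
theorem tau_pow_ge {n : ℕ} (hn : 2 ≤ n) {κ t θ : ℝ} (hκ : 0 ≤ κ) (ht : 0 < t)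
    (ht' : 2 * t ^ 2 ≤ 1) (hθ : 0 ≤ θ) :
    ENNReal.ofReal (t ^ n * (1 - 2 * t ^ 2) ^ (n - 1) * (1 + κ * θ ^ 2 / 6))
      ≤ tau κ n t θ ^ (n : ℝ) := by
  have hn0 : (0 : ℝ) < n := by positivity
  have hn1 : (0 : ℝ) < n - 1 := by
    have : (2 : ℝ) ≤ n := by exact_mod_cast hn
    linarith
  have ht1 : (1 - 2 * t ^ 2) ^ (n - 1) ≤ 1 :=
    pow_le_one₀ (by linarith) (by nlinarith)
  unfold tau
  split_ifs with h1 h2 h3 h4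
  · rw [ENNReal.ofReal_rpow_of_pos ht, h1]
    apply ENNReal.ofReal_le_ofReal
    rw [Real.rpow_natCast]
    have : 0 < t ^ n := by positivity
    nlinarith
  -- Only a lower bound on `τ` is needed, so the infinite branch is harmless and no diameter bound
  -- enters.
  · simp [ENNReal.top_rpow_of_pos hn0]
  · push Not at h3
    set s := √(κ / (n - 1)) with hs
    have hs2 : s ^ 2 = κ / (n - 1) := Real.sq_sqrt (by positivity)
    have hκ' : 0 < κ := by
      rcases hκ.lt_or_eq with h | h
      · exact h
      · simp [← h] at h1
    have hθ' : 0 < θ := by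
      rcases hθ.lt_or_eq with h | h
      · exact h
      · simp [← h] at h1
    have hs0 : 0 < s := Real.sqrt_pos.2 (by positivity)
    have hφ2 : (n - 1) * (θ * s) ^ 2 = κ * θ ^ 2 := by
      rw [mul_pow, hs2]; field_simp
    have hφ : θ * s < Real.pi := by
      apply lt_of_pow_lt_pow_left₀ 2 Real.pi_pos.le
      rw [← hφ2] at h3
      exact lt_of_mul_lt_mul_left h3 hn1.le
    have hq := sin_mul_div_sin_ge ht.le ht' (mul_pos hθ' hs0) hφ
    rw [← mul_assoc] at hq
    set Q := Real.sin (t * θ * s) / Real.sin (θ * s)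
    have hl : 0 ≤ t * (1 - 2 * t ^ 2) * (1 + (θ * s) ^ 2 / 6) :=
      mul_nonneg (mul_nonneg ht.le (by linarith)) (by positivity)
    have hQ : 0 ≤ Q := hl.trans hq
    have hQ' : (t ^ (1 / (n : ℝ)) * Q ^ (1 - 1 / (n : ℝ))) ^ (n : ℝ) = t * Q ^ (n - 1) := by
      rw [Real.mul_rpow (by positivity) (by positivity), ← Real.rpow_mul ht.le,
        ← Real.rpow_mul hQ, ← Real.rpow_natCast Q, Nat.cast_sub (by lia)]
      congr 2
      · rw [one_div_mul_cancel hn0.ne', Real.rpow_one]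
      · push_cast
        field_simp
    rw [ENNReal.ofReal_rpow_of_nonneg (by positivity) hn0.le, hQ']
    apply ENNReal.ofReal_le_ofReal
    have hb : 1 + ((n - 1 : ℕ) : ℝ) * ((θ * s) ^ 2 / 6) ≤ (1 + (θ * s) ^ 2 / 6) ^ (n - 1) :=
      one_add_mul_le_pow (by nlinarith [sq_nonneg (θ * s)]) _
    have hc : ((n - 1 : ℕ) : ℝ) = n - 1 := by rw [Nat.cast_sub (by lia)]; simp
    have hb' : 1 + κ * θ ^ 2 / 6 ≤ (1 + (θ * s) ^ 2 / 6) ^ (n - 1) := by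
      rw [← hφ2]; rw [hc] at hb; linarith
    calc t ^ n * (1 - 2 * t ^ 2) ^ (n - 1) * (1 + κ * θ ^ 2 / 6)
        ≤ t ^ n * (1 - 2 * t ^ 2) ^ (n - 1) * (1 + (θ * s) ^ 2 / 6) ^ (n - 1) := by
          have : 0 ≤ 1 - 2 * t ^ 2 := by linarith
          gcongr
      _ = t * (t * (1 - 2 * t ^ 2) * (1 + (θ * s) ^ 2 / 6)) ^ (n - 1) := by
          obtain ⟨k, rfl⟩ : ∃ k, n = k + 1 := ⟨n - 1, by lia⟩
          simp only [Nat.add_sub_cancel, mul_pow, pow_succ]; ring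
      _ ≤ t * Q ^ (n - 1) := by gcongr
  · exact absurd (lt_of_le_of_ne (by positivity) (Ne.symm h1)) h2
  · exact absurd (lt_of_le_of_ne (by positivity) (Ne.symm h1)) h2

/-- Replaces the distance `θ` between the endpoints by the distance `a` from the target to the
centre, which differs by at most `ε`. Since `θ² ≥ a² - 2εR`, the loss is absorbed in the factor `1 -
κεR/3`, and the bound depends on the target point alone. -/
theorem tau_pow_ge_of_dist {n : ℕ} (hn : 2 ≤ n) {κ t θ a ε R : ℝ} (hκ : 0 ≤ κ) (ht : 0 < t)
    (ht' : 2 * t ^ 2 ≤ 1) (hθ : 0 ≤ θ) (ha : 0 ≤ a) (hε : 0 ≤ ε) (haθ : a ≤ θ + ε) (haR : a ≤ R) :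
    ENNReal.ofReal (t ^ n * (1 - 2 * t ^ 2) ^ (n - 1) * (1 - κ * ε * R / 3))
      * ENNReal.ofReal (1 + κ * a ^ 2 / 6) ≤ tau κ n t θ ^ (n : ℝ) := by
  refine le_trans ?_ (tau_pow_ge hn hκ ht ht' hθ)
  rw [← ENNReal.ofReal_mul' (by positivity)]
  apply ENNReal.ofReal_le_ofReal
  have h0 : 0 ≤ t ^ n * (1 - 2 * t ^ 2) ^ (n - 1) :=
    mul_nonneg (by positivity) (pow_nonneg (by linarith) _)
  rw [mul_assoc]
  gcongr
  have h1 : a ^ 2 - 2 * ε * R ≤ θ ^ 2 := by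
    rcases le_total a ε with h | h
    · nlinarith
    · nlinarith
  have h2 : κ * (a ^ 2 - 2 * ε * R) ≤ κ * θ ^ 2 := by gcongr
  have h3 : 0 ≤ κ * ε * R / 3 * (κ * a ^ 2 / 6) := by
    have : 0 ≤ R := ha.trans haR
    positivity
  nlinarith

/-! ### Volumes of Euclidean balls -/

theorem euclideanBallVol_eq {n : ℕ} (hn : 0 < n) {r : ℝ} (hr : 0 ≤ r) :
    euclideanBallVol n r
      = ENNReal.ofReal (r ^ n * (√Real.pi ^ n / Real.Gamma (n / 2 + 1))) := by
  have : Nonempty (Fin n) := Fin.pos_iff_nonempty.mp hn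
  rw [euclideanBallVol, EuclideanSpace.volume_closedBall, Fintype.card_fin,
    ENNReal.ofReal_mul (by positivity), ENNReal.ofReal_pow hr]

theorem euclideanBallVol_pos {n : ℕ} {r : ℝ} (hr : 0 < r) : 0 < euclideanBallVol n r :=
  Metric.measure_closedBall_pos _ _ hr

theorem euclideanBallVol_lt_top {n : ℕ} {r : ℝ} : euclideanBallVol n r < ∞ :=
  measure_closedBall_lt_top

theorem euclideanBallVol_add_two {n : ℕ} (hn : 0 < n) {r : ℝ} (hr : 0 ≤ r) :
    euclideanBallVol (n + 2) r
      = ENNReal.ofReal (2 * Real.pi * r ^ 2 / (n + 2)) * euclideanBallVol n r := by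
  rw [euclideanBallVol_eq (by lia) hr, euclideanBallVol_eq hn hr,
    ← ENNReal.ofReal_mul (by positivity)]
  congr 1
  have hg : Real.Gamma (((n + 2 : ℕ) : ℝ) / 2 + 1)
      = ((n : ℝ) / 2 + 1) * Real.Gamma ((n : ℝ) / 2 + 1) := by
    rw [← Real.Gamma_add_one (by positivity)]
    congr 1
    push_cast; ring
  have hG : Real.Gamma ((n : ℝ) / 2 + 1) ≠ 0 := (Real.Gamma_pos_of_pos (by positivity)).ne'
  rw [hg, pow_add (√Real.pi), Real.sq_sqrt Real.pi_pos.le, pow_add r]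
  field_simp

theorem euclideanBallVol_two (r : ℝ) :
    euclideanBallVol 2 r = ENNReal.ofReal r ^ 2 * ENNReal.ofReal Real.pi := by
  simp [euclideanBallVol]

theorem euclideanBallVol_four {r : ℝ} (hr : 0 ≤ r) :
    euclideanBallVol 4 r = ENNReal.ofReal (Real.pi ^ 2 / 2 * r ^ 4) := by
  rw [show 4 = 2 + 2 by rfl, euclideanBallVol_add_two (by lia) hr, euclideanBallVol_two,
    ← ENNReal.ofReal_pow hr, ← ENNReal.ofReal_mul (by positivity),
    ← ENNReal.ofReal_mul (by positivity)]
  congr 1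
  push_cast; ring

theorem volume_closedBall_eq_euclideanBallVol {E : Type*} [NormedAddCommGroup E]
    [InnerProductSpace ℝ E] [FiniteDimensional ℝ E] [MeasurableSpace E] [BorelSpace E] {n : ℕ}
    (hE : Module.finrank ℝ E = n) (r : ℝ) :
    volume (Metric.closedBall (0 : E) r) = euclideanBallVol n r := by
  let b := (stdOrthonormalBasis ℝ E).reindex (finCongr hE)
  rw [← b.measurePreserving_repr_symm.measure_preimage
    Metric.isClosed_closedBall.measurableSet.nullMeasurableSet,
    LinearIsometryEquiv.preimage_closedBall]
  simp [euclideanBallVol]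

/-- The ball of a Euclidean space, sliced along an orthogonal decomposition. -/
theorem lintegral_euclideanBallVol_slice {m k : ℕ} {R : ℝ} (hR : 0 ≤ R) :
    ∫⁻ z in Metric.closedBall (0 : EuclideanSpace ℝ (Fin m)) R,
      euclideanBallVol k (√(R ^ 2 - ‖z‖ ^ 2)) = euclideanBallVol (m + k) R := by
  let U := EuclideanSpace ℝ (Fin m)
  let V := EuclideanSpace ℝ (Fin k)
  have hf : Module.finrank ℝ (WithLp 2 (U × V)) = m + k := by
    rw [(WithLp.linearEquiv 2 ℝ (U × V)).finrank_eq]; simp [U, V]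
  rw [← volume_closedBall_eq_euclideanBallVol hf,
    ← (WithLp.volume_preserving_toLp U V).measure_preimage
      Metric.isClosed_closedBall.measurableSet.nullMeasurableSet]
  have hset : (WithLp.toLp 2 : U × V → _) ⁻¹' Metric.closedBall 0 R
      = {p : U × V | ‖p.1‖ ^ 2 + ‖p.2‖ ^ 2 ≤ R ^ 2} := by
    ext p
    simp only [mem_preimage, mem_closedBall_zero_iff, mem_ofPred_eq]
    rw [WithLp.prod_norm_eq_of_L2, Real.sqrt_le_left hR]
    rfl
  have hm : MeasurableSet {p : U × V | ‖p.1‖ ^ 2 + ‖p.2‖ ^ 2 ≤ R ^ 2} :=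
    (isClosed_le (by fun_prop) (by fun_prop)).measurableSet
  rw [hset, Measure.volume_eq_prod, Measure.prod_apply hm,
    ← lintegral_indicator Metric.isClosed_closedBall.measurableSet]
  congr 1
  ext z
  by_cases hz : ‖z‖ ≤ R
  · rw [indicator_of_mem (by simpa using hz)]
    rw [euclideanBallVol]
    congr 1
    ext w
    have hz2 : ‖z‖ ^ 2 ≤ R ^ 2 := by gcongr
    simp only [mem_closedBall_zero_iff, mem_preimage, mem_ofPred_eq]
    rw [Real.le_sqrt (norm_nonneg _) (by linarith)]
    constructor <;> intro h <;> linarith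
  · rw [indicator_of_notMem (by simpa using hz)]
    symm
    convert measure_empty (μ := (volume : Measure V))
    ext w
    simp only [mem_preimage, mem_ofPred_eq, mem_empty_iff_false, iff_false]
    intro h
    apply hz
    exact abs_le_of_sq_le_sq' (by nlinarith [sq_nonneg ‖w‖]) hR |>.2

/-- This and the next integral interpret powers of `R² - ‖z‖²` as volumes of two- and
four-dimensional slices, so no radial integration is needed. -/
theorem lintegral_pi_mul_sq_sub_norm_sq {m : ℕ} {R : ℝ} (hR : 0 ≤ R) :
    ∫⁻ z in Metric.closedBall (0 : EuclideanSpace ℝ (Fin m)) R,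
      ENNReal.ofReal (Real.pi * (R ^ 2 - ‖z‖ ^ 2)) = euclideanBallVol (m + 2) R := by
  rw [← lintegral_euclideanBallVol_slice hR]
  refine setLIntegral_congr_fun Metric.isClosed_closedBall.measurableSet fun z hz => ?_
  have hz2 : ‖z‖ ^ 2 ≤ R ^ 2 := by
    have := mem_closedBall_zero_iff.1 hz
    gcongr
  rw [euclideanBallVol_two, ← ENNReal.ofReal_pow (Real.sqrt_nonneg _),
    Real.sq_sqrt (by linarith), ← ENNReal.ofReal_mul (by linarith), mul_comm]

theorem lintegral_pi_sq_mul_sq_sub_norm_sq_sq {m : ℕ} {R : ℝ} (hR : 0 ≤ R) :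
    ∫⁻ z in Metric.closedBall (0 : EuclideanSpace ℝ (Fin m)) R,
      ENNReal.ofReal (Real.pi ^ 2 / 2 * (R ^ 2 - ‖z‖ ^ 2) ^ 2) = euclideanBallVol (m + 4) R := by
  rw [← lintegral_euclideanBallVol_slice hR]
  refine setLIntegral_congr_fun Metric.isClosed_closedBall.measurableSet fun z hz => ?_
  have hz2 : ‖z‖ ^ 2 ≤ R ^ 2 := by
    have := mem_closedBall_zero_iff.1 hz
    gcongr
  rw [euclideanBallVol_four (Real.sqrt_nonneg _), show 4 = 2 * 2 by rfl, pow_mul,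
    Real.sq_sqrt (by linarith)]

/-! ### Volumes of balls in `S²(γ) × ℝᵐ` -/

section Model

/-- A spherical sector of `ℝ³`, in coordinates adapted to its axis. -/
theorem volume_prod_sector_ge {V : Type*} [NormedAddCommGroup V]
    [InnerProductSpace ℝ V] [FiniteDimensional ℝ V] [MeasurableSpace V] [BorelSpace V]
    (hV : Module.finrank ℝ V = 2) {c : ℝ} (hc : 0 < c) (hc' : c ≤ 1) :
    ENNReal.ofReal (2 * Real.pi / 3 * (1 - c)) ≤
      (volume : Measure (ℝ × V)) {p | 0 < p.1 ∧ p.1 ^ 2 + ‖p.2‖ ^ 2 < 1 ∧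
        c ^ 2 * (p.1 ^ 2 + ‖p.2‖ ^ 2) ≤ p.1 ^ 2} := by
  set S := {p : ℝ × V | 0 < p.1 ∧ p.1 ^ 2 + ‖p.2‖ ^ 2 < 1 ∧
        c ^ 2 * (p.1 ^ 2 + ‖p.2‖ ^ 2) ≤ p.1 ^ 2} with hS
  have : Nontrivial V := Module.nontrivial_of_finrank_pos (R := ℝ) (by lia)
  have hSm : MeasurableSet S := by
    have m1 : Measurable fun p : ℝ × V => p.1 ^ 2 := by fun_prop
    have m2 : Measurable fun p : ℝ × V => p.1 ^ 2 + ‖p.2‖ ^ 2 := by fun_prop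
    exact (measurableSet_lt measurable_const measurable_fst).inter
      ((measurableSet_lt m2 measurable_const).inter (measurableSet_le (m2.const_mul _) m1))
  have hball : ∀ r : ℝ, 0 ≤ r →
      volume (Metric.ball (0 : V) (√r)) = ENNReal.ofReal (Real.pi * r) := by
    intro r hr
    rw [InnerProductSpace.volume_ball_of_dim_even (k := 1) (by rw [hV]), hV,
      ← ENNReal.ofReal_pow (Real.sqrt_nonneg _), Real.sq_sqrt hr, ← ENNReal.ofReal_mul hr]
    congr 1
    simp [mul_comm]
  -- Slices orthogonal to the axis are discs: up to height `c` the cone bounds the radius, above it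
  -- the unit sphere does.
  have h1 : ∀ h ∈ Ioc 0 c, ENNReal.ofReal (Real.pi * (h ^ 2 * ((1 - c ^ 2) / c ^ 2)))
      ≤ volume (Prod.mk h ⁻¹' S) := by
    intro h hh
    have hcc : 0 ≤ 1 - c ^ 2 := by nlinarith
    rw [← hball _ (by positivity)]
    refine measure_mono fun w hw => ?_
    rw [mem_ball_zero_iff, Real.lt_sqrt (norm_nonneg _)] at hw
    have hw' : c ^ 2 * ‖w‖ ^ 2 < h ^ 2 * (1 - c ^ 2) := by
      have := mul_lt_mul_of_pos_left hw (show 0 < c ^ 2 by positivity)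
      calc _ < _ := this
        _ = _ := by field_simp
    have hh2 : h ^ 2 ≤ c ^ 2 := pow_le_pow_left₀ hh.1.le hh.2 2
    refine ⟨hh.1, ?_, ?_⟩
    · have : c ^ 2 * (h ^ 2 + ‖w‖ ^ 2) < c ^ 2 * 1 := by nlinarith
      exact lt_of_mul_lt_mul_left this (by positivity)
    · simp only; nlinarith
  have h2 : ∀ h ∈ Ioc c 1, ENNReal.ofReal (Real.pi * (1 - h ^ 2))
      ≤ volume (Prod.mk h ⁻¹' S) := by
    intro h hh
    have hh0 : 0 < h := hc.trans hh.1
    have hh1 : 0 ≤ 1 - h ^ 2 := by nlinarith [hh.2]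
    rw [← hball _ hh1]
    refine measure_mono fun w hw => ?_
    rw [mem_ball_zero_iff, Real.lt_sqrt (norm_nonneg _)] at hw
    have hh2 : c ^ 2 ≤ h ^ 2 := pow_le_pow_left₀ hc.le hh.1.le 2
    refine ⟨hh0, ?_, ?_⟩
    · simp only; linarith
    · simp only
      calc c ^ 2 * (h ^ 2 + ‖w‖ ^ 2) ≤ c ^ 2 * 1 := by gcongr; linarith
        _ ≤ h ^ 2 := by linarith
  have i1 : ∫⁻ h in Ioc 0 c, ENNReal.ofReal (Real.pi * (h ^ 2 * ((1 - c ^ 2) / c ^ 2)))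
      = ENNReal.ofReal (Real.pi * (c * (1 - c ^ 2) / 3)) := by
    have hcc : 0 ≤ 1 - c ^ 2 := by nlinarith
    rw [← ofReal_integral_eq_lintegral_ofReal, ← intervalIntegral.integral_of_le hc.le]
    · congr 1
      simp only [intervalIntegral.integral_const_mul, intervalIntegral.integral_mul_const,
        integral_pow]
      field_simp
      norm_num
      ring
    · exact (Continuous.integrableOn_Icc (by fun_prop)).mono_set Ioc_subset_Icc_self
    · exact Eventually.of_forall fun h => by positivity
  have i2 : ∫⁻ h in Ioc c 1, ENNReal.ofReal (Real.pi * (1 - h ^ 2))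
      = ENNReal.ofReal (Real.pi * (2 / 3 - c + c ^ 3 / 3)) := by
    rw [← ofReal_integral_eq_lintegral_ofReal, ← intervalIntegral.integral_of_le hc']
    · congr 1
      rw [intervalIntegral.integral_const_mul, intervalIntegral.integral_sub (by simp)
        (by simp), integral_pow]
      simp
      ring_nf
    · exact (Continuous.integrableOn_Icc (by fun_prop)).mono_set Ioc_subset_Icc_self
    · filter_upwards [ae_restrict_mem measurableSet_Ioc] with h hh
      have hh0 : 0 < h := hc.trans hh.1
      have hh1 : 0 ≤ 1 - h ^ 2 := by nlinarith [hh.2]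
      positivity
  rw [Measure.volume_eq_prod, Measure.prod_apply hSm]
  calc _ = ENNReal.ofReal (Real.pi * (c * (1 - c ^ 2) / 3))
        + ENNReal.ofReal (Real.pi * (2 / 3 - c + c ^ 3 / 3)) := by
        rw [← ENNReal.ofReal_add]
        · congr 1; ring
        · have hcc : 0 ≤ 1 - c ^ 2 := by nlinarith
          positivity
        · have hcc : 0 ≤ 2 / 3 - c + c ^ 3 / 3 := by
            nlinarith [mul_nonneg (sq_nonneg (1 - c)) (show 0 ≤ c + 2 by linarith)]
          positivity
    _ ≤ (∫⁻ h in Ioc 0 c, volume (Prod.mk h ⁻¹' S))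
          + ∫⁻ h in Ioc c 1, volume (Prod.mk h ⁻¹' S) := by
        rw [← i1, ← i2]
        exact add_le_add (setLIntegral_mono' measurableSet_Ioc h1)
          (setLIntegral_mono' measurableSet_Ioc h2)
    _ = ∫⁻ h in Ioc 0 c ∪ Ioc c 1, volume (Prod.mk h ⁻¹' S) := by
        rw [lintegral_union measurableSet_Ioc]
        exact Ioc_disjoint_Ioc_of_le le_rfl
    _ ≤ _ := setLIntegral_le_lintegral _ _

theorem measurable_angle_left (v : EuclideanSpace ℝ (Fin 3)) :
    Measurable fun x => InnerProductGeometry.angle x v := by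
  unfold InnerProductGeometry.angle
  exact Real.continuous_arccos.measurable.comp (by fun_prop)

theorem volume_sector_ge (y : S2) {α : ℝ} (hα : 0 ≤ α) (hα' : α ≤ 1) :
    ENNReal.ofReal (2 * Real.pi / 3 * (1 - Real.cos α)) ≤
      volume {x : EuclideanSpace ℝ (Fin 3) | x ≠ 0 ∧ ‖x‖ < 1 ∧
        InnerProductGeometry.angle x (y : EuclideanSpace ℝ (Fin 3)) ≤ α} := by
  have hy : ‖(y : EuclideanSpace ℝ (Fin 3))‖ = 1 := by simp
  set v := (y : EuclideanSpace ℝ (Fin 3))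
  set S := {x : EuclideanSpace ℝ (Fin 3) | x ≠ 0 ∧ ‖x‖ < 1 ∧ InnerProductGeometry.angle x v ≤ α}
  let K := Submodule.span ℝ {v}
  let e := LinearIsometryEquiv.toSpanUnitSingleton (𝕜 := ℝ) v hy
  let f : ℝ × Kᗮ → EuclideanSpace ℝ (Fin 3) := fun p =>
    K.orthogonalDecomposition.symm (WithLp.toLp 2 (Prod.map e id p))
  have hf : MeasurePreserving f volume volume := by
    refine K.orthogonalDecomposition.symm.measurePreserving.comp
      ((WithLp.volume_preserving_toLp K Kᗮ).comp ?_)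
    exact e.measurePreserving.prod (MeasurePreserving.id _)
  have hfv : ∀ p, f p = p.1 • v + p.2 := by
    intro p
    simp [f, e]
  have hV : Module.finrank ℝ Kᗮ = 2 := by
    have h1 := K.finrank_add_finrank_orthogonal
    have h2 : Module.finrank ℝ K = 1 := finrank_span_singleton (by
      intro h; rw [h] at hy; simp at hy)
    rw [finrank_euclideanSpace_fin] at h1
    change Module.finrank ℝ K + Module.finrank ℝ Kᗮ = 3 at h1
    omega
  have hcos : 0 < Real.cos α := Real.cos_pos_of_mem_Ioo ⟨by linarith [Real.pi_pos], by
    linarith [Real.pi_gt_three]⟩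
  have hSm : MeasurableSet S :=
    (measurableSet_singleton _).compl.inter ((measurableSet_lt measurable_norm
      measurable_const).inter (measurableSet_le (measurable_angle_left v) measurable_const))
  rw [← hf.measure_preimage hSm.nullMeasurableSet]
  refine (volume_prod_sector_ge hV hcos (Real.cos_le_one _)).trans (measure_mono ?_)
  rintro ⟨h, w⟩ ⟨h0, h1, h2⟩
  simp only at h0 h1 h2
  have hwv : inner ℝ v (w : EuclideanSpace ℝ (Fin 3)) = 0 :=
    Submodule.inner_right_of_mem_orthogonal (Submodule.mem_span_singleton_self v) w.2
  have hn : ‖f (h, w)‖ ^ 2 = h ^ 2 + ‖w‖ ^ 2 := by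
    rw [hfv, norm_add_sq_real, inner_smul_left, hwv]
    simp [norm_smul, hy]
  have hi : inner ℝ (f (h, w)) v = h := by
    rw [hfv, inner_add_left, real_inner_comm, real_inner_comm v]
    simp [inner_smul_right, hwv, hy]
  have hpos : 0 < ‖f (h, w)‖ := by
    apply lt_of_pow_lt_pow_left₀ 2 (norm_nonneg _)
    rw [hn]; simp; positivity
  refine ⟨norm_pos_iff.1 hpos, ?_, ?_⟩
  · apply lt_of_pow_lt_pow_left₀ 2 zero_le_one
    rw [hn]; simpa using h1
  · rw [InnerProductGeometry.angle, hi, hy, mul_one]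
    rw [← Real.arccos_cos hα (by linarith [Real.pi_gt_three])]
    apply Real.arccos_le_arccos
    rw [le_div_iff₀ hpos]
    apply le_of_sq_le_sq _ h0.le
    rw [mul_pow, hn]; exact h2

/-- By its definition, `toSphere` of a cap is three times the volume of the sector of the unit ball
over it. -/
theorem toSphere_cap_ge (y : S2) {α : ℝ} (hα : 0 ≤ α) (hα' : α ≤ 1) :
    ENNReal.ofReal (2 * Real.pi * (1 - Real.cos α)) ≤
      (volume : Measure (EuclideanSpace ℝ (Fin 3))).toSphere
        {u | InnerProductGeometry.angle (u : EuclideanSpace ℝ (Fin 3)) y ≤ α} := by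
  have hm : MeasurableSet
      {u : S2 | InnerProductGeometry.angle (u : EuclideanSpace ℝ (Fin 3)) y ≤ α} :=
    measurableSet_le ((measurable_angle_left _).comp measurable_subtype_coe) measurable_const
  rw [Measure.toSphere_apply' _ hm, finrank_euclideanSpace_fin]
  calc _ = ((3 : ℕ) : ℝ≥0∞) * ENNReal.ofReal (2 * Real.pi / 3 * (1 - Real.cos α)) := by
        rw [← ENNReal.ofReal_natCast, ← ENNReal.ofReal_mul (by positivity)]
        congr 1; push_cast; ring
    _ ≤ _ := by
      refine mul_le_mul_right ((volume_sector_ge y hα hα').trans (measure_mono ?_)) _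
      rintro x ⟨h0, h1, h2⟩
      have hpos : 0 < ‖x‖ := norm_pos_iff.2 h0
      refine Set.mem_smul.2 ⟨‖x‖, ⟨hpos, h1⟩, ‖x‖⁻¹ • x, ?_, ?_⟩
      · refine ⟨⟨‖x‖⁻¹ • x, ?_⟩, ?_, rfl⟩
        · simp [norm_smul, hpos.ne']
        · simpa [InnerProductGeometry.angle_smul_left_of_pos _ _ (inv_pos.2 hpos)] using h2
      · rw [smul_smul, mul_inv_cancel₀ hpos.ne', one_smul]

theorem volS_cap_ge {γ ρ : ℝ} (hγ : 0 < γ) (hρ : 0 ≤ ρ) (hργ : ρ ≤ γ) (y : S2) :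
    ENNReal.ofReal (Real.pi * ρ ^ 2 - Real.pi * (ρ ^ 2) ^ 2 / (12 * γ ^ 2))
      ≤ volS γ {u | distS γ u y ≤ ρ} := by
  have hset : {u : S2 | distS γ u y ≤ ρ}
      = {u : S2 | InnerProductGeometry.angle (u : EuclideanSpace ℝ (Fin 3)) y ≤ ρ / γ} := by
    ext u
    simp only [distS, mem_ofPred_eq]
    rw [le_div_iff₀ hγ, mul_comm]
  rw [hset, volS, Measure.smul_apply, smul_eq_mul]
  have h1 := toSphere_cap_ge y (α := ρ / γ) (by positivity) ((div_le_one hγ).2 hργ)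
  refine le_trans ?_ (mul_le_mul_right h1 _)
  rw [← ENNReal.ofReal_mul (by positivity)]
  apply ENNReal.ofReal_le_ofReal
  have h2 := cos_le_quartic (x := ρ / γ) (by positivity)
  calc _ = γ ^ 2 * (2 * Real.pi * ((ρ / γ) ^ 2 / 2 - (ρ / γ) ^ 4 / 24)) := by
        field_simp; ring
    _ ≤ _ := mul_le_mul_of_nonneg_left (mul_le_mul_of_nonneg_left (by linarith)
        (by positivity)) (by positivity)

theorem measurableSet_ballSE (γ : ℝ) {m : ℕ} (y : S2 × EuclideanSpace ℝ (Fin m)) (r : ℝ) :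
    MeasurableSet (ballSE γ y r) := by
  have h1 : Measurable fun p : S2 × EuclideanSpace ℝ (Fin m) => distS γ p.1 y.1 :=
    (((measurable_angle_left _).comp measurable_subtype_coe).const_mul γ).comp measurable_fst
  have h2 : Measurable fun p : S2 × EuclideanSpace ℝ (Fin m) => dist p.2 y.2 := by fun_prop
  exact measurableSet_le ((h1.pow_const 2).add (h2.pow_const 2)).sqrt measurable_const

instance (γ : ℝ) : IsFiniteMeasure (volS γ) := by
  unfold volS
  exact Measure.smul_finite _ ENNReal.ofReal_ne_top

theorem setLIntegral_closedBall_sub {m : ℕ} (y : EuclideanSpace ℝ (Fin m)) (r : ℝ)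
    {g : EuclideanSpace ℝ (Fin m) → ℝ≥0∞} (hg : Measurable g) :
    ∫⁻ z in Metric.closedBall y r, g (z - y) = ∫⁻ z in Metric.closedBall 0 r, g z := by
  rw [← (measurePreserving_sub_right volume y).setLIntegral_comp_preimage
    Metric.isClosed_closedBall.measurableSet hg]
  congr 2
  ext z
  simp [dist_eq_norm]

/-- Over `z` the ball is a cap of radius `ρ` with `ρ² = r² - |z - y₂|²`, of area at least `πρ² -
πρ⁴/(12γ²)`. The first term integrates to the `(m+2)`-ball; the second is `1/(6πγ²)` times the
integrand `π²ρ⁴/2` of the `(m+4)`-ball. -/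
theorem volSE_ballSE_ge {γ r : ℝ} (hγ : 0 < γ) (hr : 0 < r) (hrγ : r ≤ γ) {m : ℕ}
    (y : S2 × EuclideanSpace ℝ (Fin m)) :
    euclideanBallVol (m + 2) r ≤ volSE γ m (ballSE γ y r)
      + ENNReal.ofReal (1 / (6 * Real.pi * γ ^ 2)) * euclideanBallVol (m + 4) r := by
  have hc : 0 < 1 / (6 * Real.pi * γ ^ 2) := by have := Real.pi_pos; positivity
  have hslice : ∀ z : EuclideanSpace ℝ (Fin m), z ∈ Metric.closedBall y.2 r →
      ENNReal.ofReal (Real.pi * (r ^ 2 - dist z y.2 ^ 2)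
        - Real.pi * (r ^ 2 - dist z y.2 ^ 2) ^ 2 / (12 * γ ^ 2))
      ≤ volS γ ((fun u => (u, z)) ⁻¹' ballSE γ y r) := by
    intro z hz
    have hd : dist z y.2 ^ 2 ≤ r ^ 2 := pow_le_pow_left₀ dist_nonneg hz 2
    have hs : √(r ^ 2 - dist z y.2 ^ 2) ^ 2 = r ^ 2 - dist z y.2 ^ 2 :=
      Real.sq_sqrt (by linarith)
    have := volS_cap_ge (ρ := √(r ^ 2 - dist z y.2 ^ 2)) hγ (Real.sqrt_nonneg _)
      (((Real.sqrt_le_left hr.le).2 (by nlinarith [sq_nonneg (dist z y.2)])).trans hrγ) y.1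
    rw [hs] at this
    refine this.trans (measure_mono fun u hu => ?_)
    have hu' : distS γ u y.1 ≤ √(r ^ 2 - dist z y.2 ^ 2) := hu
    have h0 : 0 ≤ distS γ u y.1 := mul_nonneg hγ.le (InnerProductGeometry.angle_nonneg _ _)
    have h1 := pow_le_pow_left₀ h0 hu' 2
    rw [hs] at h1
    show √(distS γ u y.1 ^ 2 + dist z y.2 ^ 2) ≤ r
    rw [Real.sqrt_le_left hr.le]
    linarith
  have h1 : ∫⁻ z in Metric.closedBall y.2 r, ENNReal.ofReal (Real.pi * (r ^ 2 - dist z y.2 ^ 2))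
      = euclideanBallVol (m + 2) r := by
    rw [← lintegral_pi_mul_sq_sub_norm_sq hr.le,
      ← setLIntegral_closedBall_sub y.2 r (by fun_prop)]
    simp only [dist_eq_norm]
  have h2 : ∫⁻ z in Metric.closedBall y.2 r,
      ENNReal.ofReal (Real.pi ^ 2 / 2 * (r ^ 2 - dist z y.2 ^ 2) ^ 2)
      = euclideanBallVol (m + 4) r := by
    rw [← lintegral_pi_sq_mul_sq_sub_norm_sq_sq hr.le,
      ← setLIntegral_closedBall_sub y.2 r (by fun_prop)]
    simp only [dist_eq_norm]
  rw [← h1, ← h2, volSE, Measure.prod_apply_symm (measurableSet_ballSE γ y r),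
    ← lintegral_const_mul _ (by fun_prop)]
  refine le_trans ?_ (add_le_add_left (setLIntegral_le_lintegral (Metric.closedBall y.2 r) _) _)
  rw [← lintegral_add_right _ (by fun_prop)]
  refine setLIntegral_mono' Metric.isClosed_closedBall.measurableSet fun z hz => ?_
  refine le_trans ?_ (add_le_add_left (hslice z hz) _)
  rw [← ENNReal.ofReal_mul hc.le]
  refine le_trans (ENNReal.ofReal_le_ofReal ?_) ENNReal.ofReal_add_le
  have hpi := Real.pi_pos
  apply le_of_eq
  field_simp
  ring

/-- The volume of a ball of `S²(γ) × ℝⁿ⁻²`, bounded below to second order. -/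
theorem volSE_ballSE_ge_mul {n : ℕ} (hn : 2 ≤ n) {γ r : ℝ} (hγ : 0 < γ) (hr : 0 < r)
    (hrγ : r ≤ γ) (y : S2 × EuclideanSpace ℝ (Fin (n - 2))) :
    ENNReal.ofReal (1 - r ^ 2 / (3 * γ ^ 2 * (n + 2))) * euclideanBallVol n r
      ≤ volSE γ (n - 2) (ballSE γ y r) := by
  have h := volSE_ballSE_ge hγ hr hrγ y
  rw [show n - 2 + 4 = n + 2 by lia, show n - 2 + 2 = n by lia,
    euclideanBallVol_add_two (by lia) hr.le, ← mul_assoc,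
    ← ENNReal.ofReal_mul (by have := Real.pi_pos; positivity)] at h
  have he : 1 / (6 * Real.pi * γ ^ 2) * (2 * Real.pi * r ^ 2 / (n + 2))
      = r ^ 2 / (3 * γ ^ 2 * (n + 2)) := by
    have := Real.pi_pos
    field_simp; norm_num
  rw [he] at h
  rw [ENNReal.ofReal_sub _ (by positivity), ENNReal.ofReal_one,
    ENNReal.sub_mul fun _ _ => euclideanBallVol_lt_top.ne, one_mul]
  exact tsub_le_iff_right.2 h

end Model

/-! ### Interpolating measures between a small ball and a ball -/

section Transport

open ProbabilityTheory

theorem IsCoupling.isProbabilityMeasure {X : Type*} [MeasurableSpace X] {q : Measure (X × X)}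
    {ν₀ ν₁ : Measure X} [IsProbabilityMeasure ν₀] (h : IsCoupling q ν₀ ν₁) : IsProbabilityMeasure q := by
  have : IsProbabilityMeasure (q.map Prod.fst) := by rw [h.1]; infer_instance
  exact Measure.isProbabilityMeasure_of_map (f := Prod.fst)

/-- Gluing of two couplings along their common marginal. -/
theorem exists_glue {X : Type*} [MeasurableSpace X] [StandardBorelSpace X] [Nonempty X]
    {q₁ q₂ : Measure (X × X)} {ν₀ ν ν₁ : Measure X} [IsProbabilityMeasure ν₀] [IsProbabilityMeasure ν]
    (h₁ : IsCoupling q₁ ν₀ ν) (h₂ : IsCoupling q₂ ν ν₁) :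
    ∃ π : Measure (X × X × X), π.map (fun z => (z.2.1, z.1)) = q₁ ∧
      π.map (fun z => (z.1, z.2.2)) = q₂ := by
  have := h₁.isProbabilityMeasure
  have := h₂.isProbabilityMeasure
  have hq₁ : (q₁.map Prod.swap).fst = ν := by
    rw [Measure.fst, Measure.map_map measurable_fst measurable_swap]
    exact h₁.2
  have hq₂ : q₂.fst = ν := h₂.1
  have : IsProbabilityMeasure (q₁.map Prod.swap) :=
    Measure.isProbabilityMeasure_map measurable_swap.aemeasurable
  -- The outer points are taken conditionally independent given the middle one, which is stored as
  -- the first coordinate.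
  refine ⟨ν ⊗ₘ ((q₁.map Prod.swap).condKernel ×ₖ q₂.condKernel), ?_, ?_⟩
  · have h : (ν ⊗ₘ ((q₁.map Prod.swap).condKernel ×ₖ q₂.condKernel)).map
        (Prod.map id Prod.fst) = q₁.map Prod.swap := by
      rw [← Measure.compProd_map measurable_fst, ← Kernel.fst_eq, Kernel.fst_prod, ← hq₁,
        Measure.disintegrate]
    have h' := congrArg (Measure.map Prod.swap) h
    rw [Measure.map_map measurable_swap (by fun_prop),
      Measure.map_map measurable_swap measurable_swap, Prod.swap_swap_eq, Measure.map_id] at h'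
    exact h'
  · have h : (ν ⊗ₘ ((q₁.map Prod.swap).condKernel ×ₖ q₂.condKernel)).map
        (Prod.map id Prod.snd) = q₂ := by
      rw [← Measure.compProd_map measurable_snd, ← Kernel.snd_eq, Kernel.snd_prod, ← hq₂,
        Measure.disintegrate]
    exact h

variable {X : Type*} [MetricSpace X] [MeasurableSpace X]

theorem exists_coupling_cost_lt {ν₀ ν₁ : Measure X} {D η : ℝ≥0∞} (h : W2 ν₀ ν₁ = D) (hD : D ≠ ∞)
    (hη : η ≠ 0) : ∃ q, IsCoupling q ν₀ ν₁ ∧ cost q < D ^ 2 + η := by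
  have h2 : (⨅ q : {q : Measure (X × X) // IsCoupling q ν₀ ν₁}, cost q.1) = D ^ 2 := by
    rw [← h, W2, ← ENNReal.rpow_natCast, ← ENNReal.rpow_mul]
    norm_num
  have h3 : (⨅ q : {q : Measure (X × X) // IsCoupling q ν₀ ν₁}, cost q.1) < D ^ 2 + η := by
    rw [h2]
    exact ENNReal.lt_add_right (by simp [hD]) hη
  obtain ⟨q, hq⟩ := iInf_lt_iff.1 h3
  exact ⟨q.1, q.2, hq⟩

theorem W2_sq_le_cost {ν₀ ν₁ : Measure X} {q : Measure (X × X)} (hq : IsCoupling q ν₀ ν₁) :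
    W2 ν₀ ν₁ ^ 2 ≤ cost q := by
  rw [W2, ← ENNReal.rpow_natCast, ← ENNReal.rpow_mul]
  norm_num
  exact iInf_le_of_le ⟨q, hq⟩ le_rfl

/-- With `v²` replaced by `(w - u)²` this is an identity. The term `(u - tw)²` measures how far a
point is from being a `t`-intermediate point, and is what localises the interpolating measure. -/
theorem sq_interpolation_le {t u v w : ℝ} (ht : 0 ≤ t) (h₁ : w ≤ u + v) (h₂ : u ≤ w + v) :
    t * (1 - t) * w ^ 2 + (u - t * w) ^ 2 ≤ (1 - t) * u ^ 2 + t * v ^ 2 := by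
  have h : (w - u) ^ 2 ≤ v ^ 2 := sq_le_sq' (by linarith) (by linarith)
  nlinarith [mul_le_mul_of_nonneg_left h ht]

variable [BorelSpace X] [SecondCountableTopology X] [StandardBorelSpace X]

/-- If `ν₀` is concentrated on an `ε`-ball and `ν₁` on the concentric `R`-ball, then a
`t`-intermediate measure is concentrated on the concentric ball of radius `t R + 3 ε`. -/
theorem intermediate_measure_compl_closedBall {ν₀ ν ν₁ : Measure X} [IsProbabilityMeasure ν₀]
    [IsProbabilityMeasure ν] {x : X} {ε R t : ℝ} (hε : 0 < ε) (ht : 0 < t)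
    (ht' : t < 1) (h₀ : ν₀ (Metric.closedBall x ε)ᶜ = 0) (h₁ : ν₁ (Metric.closedBall x R)ᶜ = 0)
    (hW : W2 ν₀ ν₁ ≠ ∞) (hW₀ : W2 ν₀ ν = ENNReal.ofReal t * W2 ν₀ ν₁)
    (hW₁ : W2 ν ν₁ = ENNReal.ofReal (1 - t) * W2 ν₀ ν₁) :
    ν (Metric.closedBall x (t * R + 3 * ε))ᶜ = 0 := by
  have : Nonempty X := ⟨x⟩
  set D := W2 ν₀ ν₁ with hD
  set E := (Metric.closedBall x (t * R + 3 * ε))ᶜ with hE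
  have hEm : MeasurableSet E := Metric.isClosed_closedBall.measurableSet.compl
  have hs : (0 : ℝ) ≤ 1 - t := by linarith
  -- `W2` is an infimum, so the couplings of the two halves are only optimal up to `η`. Gluing them
  -- and integrating `sq_interpolation_le` shows that the mass outside the ball is paid for by this
  -- slack.
  have key : ∀ η : ℝ≥0∞, η ≠ 0 → ENNReal.ofReal (ε ^ 2) * ν E ≤ η := by
    intro η hη
    obtain ⟨q₁, hq₁, hc₁⟩ := exists_coupling_cost_lt hW₀ (ENNReal.mul_ne_top (by simp) hW) hη
    obtain ⟨q₂, hq₂, hc₂⟩ := exists_coupling_cost_lt hW₁ (ENNReal.mul_ne_top (by simp) hW) hη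
    obtain ⟨π, hπ₁, hπ₂⟩ := exists_glue hq₁ hq₂
    have m₁ : Measurable fun z : X × X × X => (z.2.1, z.1) := by fun_prop
    have m₂ : Measurable fun z : X × X × X => (z.1, z.2.2) := by fun_prop
    have m₃ : Measurable fun z : X × X × X => (z.2.1, z.2.2) := by fun_prop
    have e₀ : π.map (fun z => z.2.1) = ν₀ := by
      rw [← hq₁.1, ← hπ₁, Measure.map_map measurable_fst m₁]; rfl
    have e₁ : π.map (fun z => z.2.2) = ν₁ := by
      rw [← hq₂.2, ← hπ₂, Measure.map_map measurable_snd m₂]; rfl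
    have e : π.map (fun z => z.1) = ν := by
      rw [← hq₂.1, ← hπ₂, Measure.map_map measurable_fst m₂]; rfl
    have hq₃ : IsCoupling (π.map fun z => (z.2.1, z.2.2)) ν₀ ν₁ := by
      constructor
      · rw [← e₀, Measure.map_map measurable_fst m₃]; rfl
      · rw [← e₁, Measure.map_map measurable_snd m₃]; rfl
    have hcm : Measurable fun p : X × X => edist p.1 p.2 ^ 2 := by fun_prop
    have c₁ : cost q₁ = ∫⁻ z, edist z.2.1 z.1 ^ 2 ∂π := by
      rw [cost, ← hπ₁, lintegral_map hcm m₁]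
    have c₂ : cost q₂ = ∫⁻ z, edist z.1 z.2.2 ^ 2 ∂π := by
      rw [cost, ← hπ₂, lintegral_map hcm m₂]
    have c₃ : D ^ 2 ≤ ∫⁻ z, edist z.2.1 z.2.2 ^ 2 ∂π := by
      refine (W2_sq_le_cost hq₃).trans_eq ?_
      rw [cost, lintegral_map hcm m₃]
    have a₀ : ∀ᵐ z ∂π, z.2.1 ∈ Metric.closedBall x ε := by
      have : ∀ᵐ y ∂ν₀, y ∈ Metric.closedBall x ε := h₀
      rw [← e₀] at this
      exact ae_of_ae_map (by fun_prop) this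
    have a₁ : ∀ᵐ z ∂π, z.2.2 ∈ Metric.closedBall x R := by
      have : ∀ᵐ y ∂ν₁, y ∈ Metric.closedBall x R := h₁
      rw [← e₁] at this
      exact ae_of_ae_map (by fun_prop) this
    have hνE : ν E = ∫⁻ z, E.indicator 1 z.1 ∂π := by
      rw [← lintegral_indicator_one hEm, ← e, lintegral_map (measurable_one.indicator hEm)
        measurable_fst]
    have hineq : ENNReal.ofReal (t * (1 - t)) * D ^ 2 + ENNReal.ofReal (ε ^ 2) * ν E
        ≤ ENNReal.ofReal (1 - t) * cost q₁ + ENNReal.ofReal t * cost q₂ := by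
      have i₁ : Measurable fun z : X × X × X => edist z.2.1 z.1 ^ 2 := by fun_prop
      have i₂ : Measurable fun z : X × X × X => edist z.1 z.2.2 ^ 2 := by fun_prop
      have i₃ : Measurable fun z : X × X × X => edist z.2.1 z.2.2 ^ 2 := by fun_prop
      have i₄ : Measurable fun z : X × X × X => E.indicator (1 : X → ℝ≥0∞) z.1 :=
        (measurable_one.indicator hEm).comp measurable_fst
      calc _ ≤ ENNReal.ofReal (t * (1 - t)) * ∫⁻ z, edist z.2.1 z.2.2 ^ 2 ∂π
            + ENNReal.ofReal (ε ^ 2) * ν E := by gcongr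
        _ = ∫⁻ z, (ENNReal.ofReal (t * (1 - t)) * edist z.2.1 z.2.2 ^ 2
            + ENNReal.ofReal (ε ^ 2) * E.indicator 1 z.1) ∂π := by
          rw [lintegral_add_left (i₃.const_mul _), lintegral_const_mul _ i₃,
            lintegral_const_mul _ i₄, hνE]
        _ ≤ ∫⁻ z, (ENNReal.ofReal (1 - t) * edist z.2.1 z.1 ^ 2
            + ENNReal.ofReal t * edist z.1 z.2.2 ^ 2) ∂π := by
          refine lintegral_mono_ae ?_
          filter_upwards [a₀, a₁] with z hz₀ hz₁
          obtain ⟨y, x₀, x₁⟩ := z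
          simp only [Metric.mem_closedBall] at hz₀ hz₁ ⊢
          have hmain := sq_interpolation_le ht.le (dist_triangle x₀ y x₁)
            (dist_comm y x₁ ▸ dist_triangle x₀ x₁ y)
          simp only [edist_dist, ← ENNReal.ofReal_pow dist_nonneg]
          rw [← ENNReal.ofReal_mul (by positivity), ← ENNReal.ofReal_mul hs,
            ← ENNReal.ofReal_mul ht.le, ← ENNReal.ofReal_add (by positivity) (by positivity)]
          by_cases hy : y ∈ E
          · rw [indicator_of_mem hy, Pi.one_apply, mul_one,
              ← ENNReal.ofReal_add (by positivity) (by positivity)]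
            apply ENNReal.ofReal_le_ofReal
            refine le_trans ?_ hmain
            gcongr
            -- Outside the ball `d(x₀, y) > tR + 2ε`, while `t d(x₀, x₁) ≤ t(R + ε)`; as `t < 1`,
            -- the defect exceeds `ε`.
            have hy' : t * R + 3 * ε < dist y x := by
              simpa [hE, Metric.mem_closedBall] using hy
            have d₁ : dist y x ≤ dist x₀ y + dist x₀ x := by
              rw [dist_comm x₀ y]; exact dist_triangle _ _ _
            have d₂ : dist x₀ x₁ ≤ ε + R := by
              have := dist_triangle_right x₀ x₁ x
              linarith
            have d₃ : t * dist x₀ x₁ ≤ t * (ε + R) := by gcongr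
            nlinarith
          · rw [indicator_of_notMem hy, mul_zero, add_zero]
            apply ENNReal.ofReal_le_ofReal
            nlinarith [sq_nonneg (dist x₀ y - t * dist x₀ x₁)]
        _ = _ := by
          rw [lintegral_add_left (i₁.const_mul _), lintegral_const_mul _ i₁,
            lintegral_const_mul _ i₂, c₁, c₂]
    have hfin : ENNReal.ofReal (t * (1 - t)) * D ^ 2 ≠ ∞ := by
      exact ENNReal.mul_ne_top (by simp) (by simp [hW])
    refine (ENNReal.add_le_add_iff_left hfin).1 (hineq.trans ?_)
    calc _ ≤ ENNReal.ofReal (1 - t) * ((ENNReal.ofReal t * D) ^ 2 + η)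
          + ENNReal.ofReal t * ((ENNReal.ofReal (1 - t) * D) ^ 2 + η) := by gcongr
      _ = ENNReal.ofReal (t * (1 - t)) * D ^ 2 * (ENNReal.ofReal t + ENNReal.ofReal (1 - t))
          + (ENNReal.ofReal t + ENNReal.ofReal (1 - t)) * η := by
        rw [ENNReal.ofReal_mul ht.le]; ring
      _ = _ := by
        rw [← ENNReal.ofReal_add ht.le hs]; simp
  have h0 : ENNReal.ofReal (ε ^ 2) * ν E = 0 := by
    by_contra h
    by_cases hη : ENNReal.ofReal (ε ^ 2) * ν E = ∞
    · have := key 1 one_ne_zero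
      rw [hη] at this; simp at this
    · exact absurd (key _ (ENNReal.half_pos h).ne') (not_le.2 (ENNReal.half_lt_self h hη))
  exact (mul_eq_zero.1 h0).resolve_left (ENNReal.ofReal_pos.2 (by positivity)).ne'

end Transport

/-! ### Consequences of the curvature-dimension condition -/

section CurvatureDimension

/-- Hölder with weights `1 - 1/N` and `1/N`, applied to `∫_B ρ^{1-1/N} dμ`; the total mass of `ρ` is
`1`. -/
theorem negRenyi_le {X : Type*} [MeasurableSpace X] {μ ν : Measure X} [SigmaFinite μ]
    [IsProbabilityMeasure ν] (hac : ν ≪ μ) {N : ℝ} (hN : 1 ≤ N) {B : Set X}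
    (hBm : MeasurableSet B) (hB : ν Bᶜ = 0) : negRenyi N ν μ ≤ μ B ^ (1 / N) := by
  have hN0 : 0 < N := by linarith
  have hN1 : 1 / N ≤ 1 := (div_le_one hN0).2 hN
  have hBa : ∀ᵐ x ∂ν, x ∈ B := hB
  calc negRenyi N ν μ = ∫⁻ x, B.indicator (fun x => ν.rnDeriv μ x ^ (-1 / N)) x ∂ν := by
        refine lintegral_congr_ae ?_
        filter_upwards [hBa] with x hx
        rw [indicator_of_mem hx]
    _ = ∫⁻ x, ν.rnDeriv μ x * B.indicator (fun x => ν.rnDeriv μ x ^ (-1 / N)) x ∂μ := by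
        rw [lintegral_rnDeriv_mul hac]
        exact (((Measure.measurable_rnDeriv ν μ).pow_const _).indicator hBm).aemeasurable
    _ ≤ ∫⁻ x, ν.rnDeriv μ x ^ (1 - 1 / N) * B.indicator 1 x ^ (1 / N) ∂μ := by
        refine lintegral_mono_ae ?_
        filter_upwards [Measure.rnDeriv_lt_top ν μ] with x hx
        by_cases hxB : x ∈ B
        · rw [indicator_of_mem hxB, indicator_of_mem hxB, Pi.one_apply, ENNReal.one_rpow, mul_one]
          by_cases h0 : ν.rnDeriv μ x = 0
          · rw [h0, zero_mul]; exact zero_le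
          · rw [sub_eq_add_neg, ENNReal.rpow_add _ _ h0 hx.ne, ENNReal.rpow_one, neg_div]
        · rw [indicator_of_notMem hxB, mul_zero]; exact zero_le
    _ ≤ (∫⁻ x, ν.rnDeriv μ x ∂μ) ^ (1 - 1 / N) * (∫⁻ x, B.indicator 1 x ∂μ) ^ (1 / N) :=
        ENNReal.lintegral_mul_norm_pow_le (Measure.measurable_rnDeriv ν μ).aemeasurable
          (measurable_one.indicator hBm).aemeasurable (by linarith) (by positivity) (by ring)
    _ = μ B ^ (1 / N) := by
        rw [Measure.lintegral_rnDeriv hac, lintegral_indicator_one hBm]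
        simp

variable {X : Type*} [MetricSpace X] [MeasurableSpace X]

theorem memP2_of_compl_closedBall {μ ν : Measure X} [IsProbabilityMeasure ν] (hac : ν ≪ μ) {x : X}
    {r : ℝ} (h : ν (Metric.closedBall x r)ᶜ = 0) : MemP2 μ ν := by
  refine ⟨inferInstance, ⟨x, ?_⟩, hac⟩
  have ha : ∀ᵐ y ∂ν, y ∈ Metric.closedBall x r := h
  calc ∫⁻ y, edist x y ^ 2 ∂ν ≤ ∫⁻ y, ENNReal.ofReal r ^ 2 ∂ν := by
        refine lintegral_mono_ae ?_
        filter_upwards [ha] with y hy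
        rw [edist_dist, dist_comm]
        gcongr
        exact hy
    _ < ∞ := by simp

theorem W2_ne_top_of_compl_closedBall [OpensMeasurableSpace X] {ν₀ ν₁ : Measure X}
    [IsProbabilityMeasure ν₀] {q : Measure (X × X)} (hq : IsCoupling q ν₀ ν₁) {x : X} {r R : ℝ}
    (h₀ : ν₀ (Metric.closedBall x r)ᶜ = 0) (h₁ : ν₁ (Metric.closedBall x R)ᶜ = 0) :
    W2 ν₀ ν₁ ≠ ∞ := by
  have := hq.isProbabilityMeasure
  have a₀ : ∀ᵐ p ∂q, p.1 ∈ Metric.closedBall x r := by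
    have : ∀ᵐ y ∂ν₀, y ∈ Metric.closedBall x r := h₀
    rw [← hq.1] at this
    exact ae_of_ae_map (by fun_prop) this
  have a₁ : ∀ᵐ p ∂q, p.2 ∈ Metric.closedBall x R := by
    have : ∀ᵐ y ∂ν₁, y ∈ Metric.closedBall x R := h₁
    rw [← hq.2] at this
    exact ae_of_ae_map (by fun_prop) this
  have hc : cost q < ∞ := by
    calc cost q ≤ ∫⁻ p, ENNReal.ofReal (r + R) ^ 2 ∂q := by
          refine lintegral_mono_ae ?_
          filter_upwards [a₀, a₁] with p hp₀ hp₁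
          rw [edist_dist]
          gcongr
          exact (dist_triangle_right p.1 p.2 x).trans (add_le_add hp₀ hp₁)
      _ < ∞ := by simp
  intro h
  have := (W2_sq_le_cost hq).trans_lt hc
  simp [h] at this

variable [BorelSpace X] [SecondCountableTopology X] [StandardBorelSpace X]

/-- The curvature-dimension inequality for the contraction of a set of finite measure towards a
small ball. -/
theorem CD.setLIntegral_le {μ : Measure X} [SigmaFinite μ] [μ.IsOpenPosMeasure] {n : ℕ}
    (hn : 2 ≤ n) {κ : ℝ} (hκ : 0 ≤ κ) (hCD : CD κ n μ) {x : X} {ε R t : ℝ} (hε : 0 < ε)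
    (ht : 0 < t) (ht' : 2 * t ^ 2 ≤ 1) (hμε : μ (Metric.closedBall x ε) ≠ ∞)
    {A : Set X} (hAm : MeasurableSet A) (hA : A ⊆ Metric.closedBall x R) (hμA : μ A ≠ ∞) :
    ENNReal.ofReal (t ^ n * (1 - 2 * t ^ 2) ^ (n - 1) * (1 - κ * ε * R / 3))
      * ∫⁻ y in A, ENNReal.ofReal (1 + κ * dist y x ^ 2 / 6) ∂μ
      ≤ μ (Metric.closedBall x (t * R + 3 * ε)) := by
  rcases eq_or_ne (μ A) 0 with hA0 | hA0
  · rw [setLIntegral_measure_zero A _ hA0, mul_zero]; exact zero_le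
  set h : X → ℝ≥0∞ := fun y => ENNReal.ofReal (1 + κ * dist y x ^ 2 / 6) with hh
  have hhm : Measurable h := by fun_prop
  have hh1 : ∀ y, 1 ≤ h y := fun y => by
    rw [hh, ENNReal.one_le_ofReal]
    have : 0 ≤ κ * dist y x ^ 2 / 6 := by positivity
    linarith
  have hh0 : ∀ y, h y ≠ 0 := fun y => (zero_lt_one.trans_le (hh1 y)).ne'
  set I := ∫⁻ y in A, h y ∂μ with hI
  have hI0 : I ≠ 0 := by
    have : μ A ≤ I := by
      calc μ A = ∫⁻ y in A, 1 ∂μ := by simp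
        _ ≤ I := lintegral_mono hh1
    intro h0
    rw [h0] at this
    exact hA0 (le_antisymm this (zero_le))
  have hIt : I ≠ ∞ := by
    refine ne_top_of_le_ne_top (b := ENNReal.ofReal (1 + κ * R ^ 2 / 6) * μ A)
      (ENNReal.mul_ne_top (by simp) hμA) ?_
    calc I ≤ ∫⁻ y in A, ENNReal.ofReal (1 + κ * R ^ 2 / 6) ∂μ := by
          refine setLIntegral_mono' hAm fun y hy => ?_
          have : dist y x ≤ R := hA hy
          simp only [hh]
          gcongr
      _ = _ := by simp
  set C := ENNReal.ofReal (t ^ n * (1 - 2 * t ^ 2) ^ (n - 1) * (1 - κ * ε * R / 3)) with hC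
  set B := Metric.closedBall x ε with hBdef
  have hBm : MeasurableSet B := Metric.isClosed_closedBall.measurableSet
  have hμB : μ B ≠ 0 := (Metric.measure_closedBall_pos μ x hε).ne'
  set ν₀ : Measure X := ProbabilityTheory.cond μ B with hν₀
  have : IsProbabilityMeasure ν₀ := ProbabilityTheory.cond_isProbabilityMeasure_of_finite hμB hμε
  have hν₀B : ν₀ Bᶜ = 0 := by
    rw [hν₀, ProbabilityTheory.cond_apply hBm]; simp
  have hν₀μ : ν₀ ≪ μ := ProbabilityTheory.cond_absolutelyContinuous
  -- The density is proportional to the distortion bound, so that `τ · ρ₁^{-1/n}` is bounded below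
  -- by the constant `(C I)^{1/n}`.
  set g : X → ℝ≥0∞ := A.indicator fun y => h y * I⁻¹ with hg
  have hgm : Measurable g := (hhm.mul_const _).indicator hAm
  set ν₁ : Measure X := μ.withDensity g with hν₁
  have hν₁A : ν₁ Aᶜ = 0 := by
    rw [hν₁, withDensity_apply _ hAm.compl]
    rw [setLIntegral_congr_fun (g := fun _ => 0) hAm.compl
      (fun y hy => by rw [hg, indicator_of_notMem hy])]
    simp
  have hν₁R : ν₁ (Metric.closedBall x R)ᶜ = 0 := measure_mono_null (compl_subset_compl.2 hA) hν₁A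
  have hν₁p : IsProbabilityMeasure ν₁ := by
    constructor
    rw [hν₁, withDensity_apply _ MeasurableSet.univ, Measure.restrict_univ, hg,
      lintegral_indicator hAm, lintegral_mul_const _ hhm, ← hI, ENNReal.mul_inv_cancel hI0 hIt]
  have hν₁μ : ν₁ ≪ μ := withDensity_absolutelyContinuous _ _
  obtain ⟨q, Γ, ⟨hq, -⟩, ⟨hΓ0, hΓ1, hΓ, hΓW⟩, hineq⟩ := hCD ν₀ ν₁
    (memP2_of_compl_closedBall hν₀μ hν₀B) (memP2_of_compl_closedBall hν₁μ hν₁R)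
  have := hq.isProbabilityMeasure
  have ht1 : t < 1 := by nlinarith
  have hm0 : (0 : ℝ) ∈ Icc (0 : ℝ) 1 := ⟨le_rfl, zero_le_one⟩
  have hm1 : (1 : ℝ) ∈ Icc (0 : ℝ) 1 := ⟨zero_le_one, le_rfl⟩
  have hmt : t ∈ Icc (0 : ℝ) 1 := ⟨ht.le, ht1.le⟩
  have : IsProbabilityMeasure (Γ t) := (hΓ t hmt).1
  have hsupp : Γ t (Metric.closedBall x (t * R + 3 * ε))ᶜ = 0 := by
    refine intermediate_measure_compl_closedBall hε ht ht1 hν₀B hν₁R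
      (W2_ne_top_of_compl_closedBall hq hν₀B hν₁R) ?_ ?_
    · rw [← hΓ0, hΓW 0 hm0 t hmt, hΓ0]
      simp [abs_of_pos ht]
    · rw [← hΓ1, hΓW t hmt 1 hm1, hΓ1, abs_sub_comm, abs_of_nonneg (by linarith)]
  have hn1 : (1 : ℝ) ≤ n := by exact_mod_cast (by lia : 1 ≤ n)
  have hn0 : (0 : ℝ) < n := by linarith
  have hup := (hineq t hmt n le_rfl).trans (negRenyi_le (hΓ t hmt).2.2 hn1
    Metric.isClosed_closedBall.measurableSet hsupp)
  have a₀ : ∀ᵐ p ∂q, p.1 ∈ B := by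
    have : ∀ᵐ y ∂ν₀, y ∈ B := hν₀B
    rw [← hq.1] at this
    exact ae_of_ae_map (by fun_prop) this
  have a₁ : ∀ᵐ p ∂q, p.2 ∈ A ∧ ν₁.rnDeriv μ p.2 = g p.2 := by
    have h1 : ∀ᵐ y ∂ν₁, y ∈ A := hν₁A
    have h2 : ∀ᵐ y ∂ν₁, ν₁.rnDeriv μ y = g y := hν₁μ.ae_le (Measure.rnDeriv_withDensity μ hgm)
    have h3 : ∀ᵐ y ∂(q.map Prod.snd), y ∈ A ∧ ν₁.rnDeriv μ y = g y := by
      rw [hq.2]; exact h1.and h2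
    exact ae_of_ae_map measurable_snd.aemeasurable h3
  have hlow : (C * I) ^ (1 / (n : ℝ))
      ≤ μ (Metric.closedBall x (t * R + 3 * ε)) ^ (1 / (n : ℝ)) := by
    refine le_trans ?_ hup
    calc (C * I) ^ (1 / (n : ℝ)) = ∫⁻ _, (C * I) ^ (1 / (n : ℝ)) ∂q := by simp
      _ ≤ _ := by
        refine lintegral_mono_ae ?_
        filter_upwards [a₀, a₁] with p hp₀ hp₁
        -- The nonnegative contribution of `ν₀` is discarded.
        refine le_trans ?_ le_add_self
        have hd₀ : dist p.1 x ≤ ε := hp₀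
        have hd₁ : dist p.2 x ≤ R := hA hp₁.1
        have hτ := tau_pow_ge_of_dist hn hκ ht ht' (dist_nonneg (x := p.1) (y := p.2))
          (dist_nonneg (x := p.2) (y := x)) hε.le
          (show dist p.2 x ≤ dist p.1 p.2 + ε from
            (dist_triangle p.2 p.1 x).trans (by rw [dist_comm p.2 p.1]; linarith)) hd₁
        have hτ' : (C * h p.2) ^ (1 / (n : ℝ)) ≤ tau κ n t (dist p.1 p.2) := by
          have := ENNReal.rpow_le_rpow hτ (show 0 ≤ 1 / (n : ℝ) by positivity)
          rwa [← ENNReal.rpow_mul, mul_one_div_cancel hn0.ne', ENNReal.rpow_one] at this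
        rw [hp₁.2, hg, indicator_of_mem hp₁.1, neg_div, ENNReal.rpow_neg, ← ENNReal.inv_rpow]
        refine le_trans ?_ (mul_le_mul_left hτ' _)
        rw [← ENNReal.mul_rpow_of_nonneg _ _ (by positivity),
          ENNReal.mul_inv (Or.inl (hh0 _)) (Or.inl ENNReal.ofReal_ne_top), inv_inv]
        apply le_of_eq
        congr 1
        calc C * I = C * (h p.2 * (h p.2)⁻¹) * I := by
              rw [ENNReal.mul_inv_cancel (hh0 _) ENNReal.ofReal_ne_top, mul_one]
          _ = _ := by ring
  exact (ENNReal.rpow_le_rpow_iff (by positivity)).1 hlow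

theorem exists_closedBall_measure_ne_top {Y : Type*} [PseudoMetricSpace Y] [MeasurableSpace Y]
    (μ : Measure Y) [IsLocallyFiniteMeasure μ] (x : Y) :
    ∃ δ > 0, ∀ r ≤ δ, μ (Metric.closedBall x r) ≠ ∞ := by
  obtain ⟨s, hs, hμs⟩ := μ.finiteAt_nhds x
  obtain ⟨δ, hδ, hδs⟩ := Metric.nhds_basis_closedBall.mem_iff.1 hs
  exact ⟨δ, hδ, fun r hr =>
    ((measure_mono ((Metric.closedBall_subset_closedBall hr).trans hδs)).trans_lt hμs).ne⟩

end CurvatureDimension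

/-! ### Volume comparison -/

section Comparison

/-- Layer cake: the superlevel sets of `R² - d²` are concentric balls, so comparing balls compares
these integrals. -/
theorem lintegral_sq_sub_dist_sq_eq {X : Type*} [PseudoMetricSpace X] [MeasurableSpace X]
    [OpensMeasurableSpace X] (μ : Measure X) (x : X) (R : ℝ) :
    ∫⁻ z, ENNReal.ofReal (R ^ 2 - dist z x ^ 2) ∂μ
      = ∫⁻ s in Ioi (0 : ℝ), μ (Metric.ball x (√(R ^ 2 - s))) := by
  have hc := lintegral_eq_lintegral_meas_lt μ (f := fun z => max (R ^ 2 - dist z x ^ 2) 0)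
    (Eventually.of_forall fun z => le_max_right _ _) (by fun_prop)
  simp only [ENNReal.ofReal_max, ENNReal.ofReal_zero, max_eq_left zero_le] at hc
  rw [hc]
  refine setLIntegral_congr_fun measurableSet_Ioi fun s hs => ?_
  have hs0 : 0 < s := hs
  congr 1
  ext z
  rw [Metric.mem_ball, Real.lt_sqrt dist_nonneg, mem_ofPred_eq, lt_max_iff]
  constructor
  · rintro (h | h) <;> linarith
  · intro h; left; linarith

theorem lintegral_sq_sub_dist_sq_le {X Y : Type*} [PseudoMetricSpace X] [MeasurableSpace X]
    [OpensMeasurableSpace X] [PseudoMetricSpace Y] [MeasurableSpace Y] [OpensMeasurableSpace Y]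
    {μ : Measure X} {ν : Measure Y} {x : X} {y : Y}
    (h : ∀ r > 0, μ (Metric.ball x r) ≤ ν (Metric.ball y r)) (R : ℝ) :
    ∫⁻ z, ENNReal.ofReal (R ^ 2 - dist z x ^ 2) ∂μ
      ≤ ∫⁻ z, ENNReal.ofReal (R ^ 2 - dist z y ^ 2) ∂ν := by
  rw [lintegral_sq_sub_dist_sq_eq, lintegral_sq_sub_dist_sq_eq]
  refine lintegral_mono fun s => ?_
  rcases (Real.sqrt_nonneg (R ^ 2 - s)).eq_or_lt with h0 | h0
  · simp [← h0]
  · exact h _ h0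

theorem lintegral_sq_sub_norm_sq {n : ℕ} (hn : 0 < n) {R : ℝ} (hR : 0 ≤ R) :
    ∫⁻ z : EuclideanSpace ℝ (Fin n), ENNReal.ofReal (R ^ 2 - dist z 0 ^ 2)
      = ENNReal.ofReal (2 * R ^ 2 / (n + 2)) * euclideanBallVol n R := by
  have hpi : ENNReal.ofReal Real.pi ≠ 0 := (ENNReal.ofReal_pos.2 Real.pi_pos).ne'
  rw [← ENNReal.mul_right_inj hpi ENNReal.ofReal_ne_top, ← mul_assoc,
    ← ENNReal.ofReal_mul Real.pi_pos.le,
    show Real.pi * (2 * R ^ 2 / (n + 2)) = 2 * Real.pi * R ^ 2 / (n + 2) by ring,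
    ← euclideanBallVol_add_two hn hR, ← lintegral_pi_mul_sq_sub_norm_sq hR,
    ← lintegral_const_mul _ (by fun_prop),
    ← lintegral_indicator Metric.isClosed_closedBall.measurableSet]
  refine lintegral_congr fun z => ?_
  rw [← ENNReal.ofReal_mul Real.pi_pos.le, dist_zero_right]
  by_cases hz : z ∈ Metric.closedBall (0 : EuclideanSpace ℝ (Fin n)) R
  · rw [indicator_of_mem hz]
  · rw [indicator_of_notMem hz, ENNReal.ofReal_of_nonpos]
    rw [mem_closedBall_zero_iff, not_le] at hz
    have : R ^ 2 ≤ ‖z‖ ^ 2 := by gcongr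
    nlinarith [Real.pi_pos]

variable {X : Type*} [MetricSpace X] [MeasurableSpace X]
  [BorelSpace X] [SecondCountableTopology X] [StandardBorelSpace X]

/-- The infinitesimal form of the contraction inequality, for sets of finite measure. -/
theorem CD.setLIntegral_le_euclideanBallVol_of_ne_top {μ : Measure X} [IsLocallyFiniteMeasure μ]
    [μ.IsOpenPosMeasure] {n : ℕ} (hn : 2 ≤ n) {κ : ℝ} (hκ : 0 ≤ κ) (hdim : NDimensional n μ)
    (hCD : CD κ n μ) {x : X} {R : ℝ} (hR : 0 < R) {A : Set X} (hAm : MeasurableSet A)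
    (hA : A ⊆ Metric.closedBall x R) (hμA : μ A ≠ ∞) :
    ∫⁻ y in A, ENNReal.ofReal (1 + κ * dist y x ^ 2 / 6) ∂μ ≤ euclideanBallVol n R := by
  set I := ∫⁻ y in A, ENNReal.ofReal (1 + κ * dist y x ^ 2 / 6) ∂μ
  set ω := √Real.pi ^ n / Real.Gamma ((n : ℝ) / 2 + 1) with hω
  have hω0 : 0 ≤ ω := by
    have := Real.Gamma_pos_of_pos (show 0 < (n : ℝ) / 2 + 1 by positivity)
    positivity
  obtain ⟨δ, hδ, hδf⟩ := exists_closedBall_measure_ne_top μ x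
  have hid : Tendsto (fun t : ℝ => t) (𝓝[>] 0) (𝓝 0) :=
    tendsto_nhdsWithin_of_tendsto_nhds tendsto_id
  have hs : Tendsto (fun t : ℝ => t * R + 3 * t ^ 2) (𝓝[>] 0) (𝓝[>] 0) := by
    refine tendsto_nhdsWithin_iff.2 ⟨?_, ?_⟩
    · have : Tendsto (fun t : ℝ => t * R + 3 * t ^ 2) (𝓝[>] 0) (𝓝 (0 * R + 3 * 0 ^ 2)) :=
        (hid.mul_const R).add ((hid.pow 2).const_mul 3)
      simpa using this
    · filter_upwards [self_mem_nhdsWithin] with t ht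
      have : 0 < t := ht
      exact mem_Ioi.2 (by positivity)
  have hlhs : Tendsto (fun t : ℝ =>
      ENNReal.ofReal ((1 - 2 * t ^ 2) ^ (n - 1) * (1 - κ * t ^ 2 * R / 3)) * I)
      (𝓝[>] 0) (𝓝 (1 * I)) := by
    refine ENNReal.Tendsto.mul_const ?_ (Or.inl one_ne_zero)
    rw [← ENNReal.ofReal_one]
    refine ENNReal.tendsto_ofReal ?_
    have : Continuous fun t : ℝ => (1 - 2 * t ^ 2) ^ (n - 1) * (1 - κ * t ^ 2 * R / 3) := by
      fun_prop
    have := (this.tendsto 0).mono_left (nhdsWithin_le_nhds (s := Ioi 0))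
    simpa using this
  have hrhs : Tendsto (fun t : ℝ => μ (Metric.closedBall x (t * R + 3 * t ^ 2))
      / euclideanBallVol n (t * R + 3 * t ^ 2) * ENNReal.ofReal ((R + 3 * t) ^ n * ω))
      (𝓝[>] 0) (𝓝 (1 * ENNReal.ofReal (R ^ n * ω))) := by
    refine ENNReal.Tendsto.mul ((hdim x).comp hs) (Or.inl one_ne_zero) ?_
      (Or.inr ENNReal.one_ne_top)
    refine ENNReal.tendsto_ofReal ?_
    have : Continuous fun t : ℝ => (R + 3 * t) ^ n * ω := by fun_prop
    have := (this.tendsto 0).mono_left (nhdsWithin_le_nhds (s := Ioi 0))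
    simpa using this
  rw [euclideanBallVol_eq (by lia) hR.le, ← one_mul I, ← one_mul (ENNReal.ofReal _)]
  refine le_of_tendsto_of_tendsto hlhs hrhs ?_
  have h1 : ∀ᶠ t : ℝ in 𝓝[>] 0, t ^ 2 < δ := by
    have : Tendsto (fun t : ℝ => t ^ 2) (𝓝[>] 0) (𝓝 (0 ^ 2)) := hid.pow 2
    exact this.eventually_lt_const (by simpa using hδ)
  have h2 : ∀ᶠ t : ℝ in 𝓝[>] 0, 2 * t ^ 2 < 1 := by
    have : Tendsto (fun t : ℝ => 2 * t ^ 2) (𝓝[>] 0) (𝓝 (2 * 0 ^ 2)) := (hid.pow 2).const_mul 2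
    exact this.eventually_lt_const (by simp)
  filter_upwards [self_mem_nhdsWithin, h1, h2] with t ht ht1 ht2
  have ht0 : 0 < t := ht
  -- The choice `ε = t²` is negligible against `tR`: the radius is `t(R + 3t)`, and `tⁿ` cancels on
  -- both sides.
  have hmain := hCD.setLIntegral_le hn hκ (ε := t ^ 2) (by positivity) ht0 ht2.le
    (hδf _ ht1.le) hAm hA hμA
  have hs0 : 0 < t * R + 3 * t ^ 2 := by positivity
  have htn : ENNReal.ofReal (t ^ n) ≠ 0 := (ENNReal.ofReal_pos.2 (by positivity)).ne'
  have hV : euclideanBallVol n (t * R + 3 * t ^ 2)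
      = ENNReal.ofReal (t ^ n) * ENNReal.ofReal ((R + 3 * t) ^ n * ω) := by
    rw [euclideanBallVol_eq (by lia) hs0.le, ← ENNReal.ofReal_mul (by positivity), ← mul_assoc,
      ← mul_pow]
    congr 3
    ring
  rw [← ENNReal.mul_le_mul_iff_right htn ENNReal.ofReal_ne_top]
  calc _ = ENNReal.ofReal (t ^ n * (1 - 2 * t ^ 2) ^ (n - 1) * (1 - κ * t ^ 2 * R / 3)) * I := by
        rw [← mul_assoc, ← ENNReal.ofReal_mul (by positivity), mul_assoc (t ^ n)]
    _ ≤ _ := hmain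
    _ = μ (Metric.closedBall x (t * R + 3 * t ^ 2)) / euclideanBallVol n (t * R + 3 * t ^ 2)
        * euclideanBallVol n (t * R + 3 * t ^ 2) := by
        rw [ENNReal.div_mul_cancel (euclideanBallVol_pos hs0).ne' euclideanBallVol_lt_top.ne]
    _ = _ := by rw [hV]; ring

theorem CD.setLIntegral_closedBall_le {μ : Measure X} [IsLocallyFiniteMeasure μ]
    [μ.IsOpenPosMeasure] {n : ℕ} (hn : 2 ≤ n) {κ : ℝ} (hκ : 0 ≤ κ) (hdim : NDimensional n μ)
    (hCD : CD κ n μ) (x : X) {R : ℝ} (hR : 0 < R) :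
    ∫⁻ y in Metric.closedBall x R, ENNReal.ofReal (1 + κ * dist y x ^ 2 / 6) ∂μ
      ≤ euclideanBallVol n R := by
  have hm : MeasurableSet (Metric.closedBall x R) := Metric.isClosed_closedBall.measurableSet
  refine hCD.setLIntegral_le_euclideanBallVol_of_ne_top hn hκ hdim hR hm subset_rfl ?_
  intro htop
  -- Local finiteness does not make large balls finite. A ball of infinite measure would contain a
  -- set of finite measure exceeding the Euclidean volume, against the bound for such sets.
  obtain ⟨A, hAm, hA, hVA, hμA⟩ := Measure.exists_subset_measure_lt_top (μ := μ) hm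
    (r := euclideanBallVol n R) (by rw [htop]; exact euclideanBallVol_lt_top)
  have h := hCD.setLIntegral_le_euclideanBallVol_of_ne_top hn hκ hdim hR hAm hA hμA.ne
  refine absurd (le_trans ?_ h) (not_le.2 hVA)
  calc μ A = ∫⁻ y in A, 1 ∂μ := by simp
    _ ≤ _ := lintegral_mono fun y => by
      rw [ENNReal.one_le_ofReal]
      have : 0 ≤ κ * dist y x ^ 2 / 6 := by positivity
      linarith

/-- Bishop's inequality with Euclidean balls. -/
theorem CD.measure_closedBall_le {μ : Measure X} [IsLocallyFiniteMeasure μ]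
    [μ.IsOpenPosMeasure] {n : ℕ} (hn : 2 ≤ n) {κ : ℝ} (hκ : 0 ≤ κ) (hdim : NDimensional n μ)
    (hCD : CD κ n μ) (x : X) {R : ℝ} (hR : 0 < R) :
    μ (Metric.closedBall x R) ≤ euclideanBallVol n R := by
  refine le_trans ?_ (hCD.setLIntegral_closedBall_le hn hκ hdim x hR)
  calc μ (Metric.closedBall x R) = ∫⁻ y in Metric.closedBall x R, 1 ∂μ := by simp
    _ ≤ _ := lintegral_mono fun y => by
      rw [ENNReal.one_le_ofReal]
      have : 0 ≤ κ * dist y x ^ 2 / 6 := by positivity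
      linarith

/-- Bishop's inequality, to second order in the radius. -/
theorem CD.mul_measure_closedBall_le {μ : Measure X} [IsLocallyFiniteMeasure μ]
    [μ.IsOpenPosMeasure] {n : ℕ} (hn : 2 ≤ n) {κ : ℝ} (hκ : 0 ≤ κ) (hdim : NDimensional n μ)
    (hCD : CD κ n μ) (x : X) {R : ℝ} (hR : 0 < R) :
    ENNReal.ofReal (1 + κ * R ^ 2 / 6) * μ (Metric.closedBall x R)
      ≤ ENNReal.ofReal (1 + κ * R ^ 2 / (3 * (n + 2))) * euclideanBallVol n R := by
  have h1 := hCD.setLIntegral_closedBall_le hn hκ hdim x hR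
  have h2 : ∫⁻ z, ENNReal.ofReal (R ^ 2 - dist z x ^ 2) ∂μ
      ≤ ENNReal.ofReal (2 * R ^ 2 / (n + 2)) * euclideanBallVol n R := by
    rw [← lintegral_sq_sub_norm_sq (by lia) hR.le]
    refine lintegral_sq_sub_dist_sq_le (fun r hr => ?_) R
    have : Nontrivial (EuclideanSpace ℝ (Fin n)) :=
      Module.nontrivial_of_finrank_pos (R := ℝ) (by rw [finrank_euclideanSpace_fin]; lia)
    rw [← Measure.addHaar_closedBall_eq_addHaar_ball]
    exact (measure_mono Metric.ball_subset_closedBall).trans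
      (hCD.measure_closedBall_le hn hκ hdim x hr)
  calc _ = ∫⁻ y in Metric.closedBall x R, ENNReal.ofReal (1 + κ * R ^ 2 / 6) ∂μ := by simp
    -- On the ball, `1 + κR²/6` is the weight `1 + κd²/6` plus `κ/6` times `R² - d²`.
    _ ≤ ∫⁻ y in Metric.closedBall x R, (ENNReal.ofReal (1 + κ * dist y x ^ 2 / 6)
        + ENNReal.ofReal (κ / 6) * ENNReal.ofReal (R ^ 2 - dist y x ^ 2)) ∂μ := by
        refine lintegral_mono fun y => ?_
        rw [← ENNReal.ofReal_mul (by positivity)]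
        refine le_trans (ENNReal.ofReal_le_ofReal ?_) ENNReal.ofReal_add_le
        apply le_of_eq
        ring
    _ = (∫⁻ y in Metric.closedBall x R, ENNReal.ofReal (1 + κ * dist y x ^ 2 / 6) ∂μ)
        + ENNReal.ofReal (κ / 6)
          * ∫⁻ y in Metric.closedBall x R, ENNReal.ofReal (R ^ 2 - dist y x ^ 2) ∂μ := by
        rw [lintegral_add_left (by fun_prop), lintegral_const_mul _ (by fun_prop)]
    _ ≤ euclideanBallVol n R + ENNReal.ofReal (κ / 6)
          * (ENNReal.ofReal (2 * R ^ 2 / (n + 2)) * euclideanBallVol n R) := by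
        gcongr
        exact (setLIntegral_le_lintegral _ _).trans h2
    _ = _ := by
        rw [ENNReal.ofReal_add zero_le_one (by positivity), ENNReal.ofReal_one, add_mul, one_mul,
          ← mul_assoc, ← ENNReal.ofReal_mul (by positivity)]
        congr 3
        field_simp
        ring

end Comparison

end VolumicScalar

end

theorem theorem1p1 {X : Type*} [MetricSpace X] [CompleteSpace X]
    [TopologicalSpace.SeparableSpace X] [MeasurableSpace X] [BorelSpace X]
    (hX : VolumicScalar.IsLengthMetric X)
    (μ : Measure X) [IsLocallyFiniteMeasure μ] [μ.IsOpenPosMeasure]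
    (n : ℕ) (hn : 2 ≤ n) (κ : ℝ) (hκ : 0 ≤ κ)
    (hdim : VolumicScalar.NDimensional n μ)
    (hCD : VolumicScalar.CD κ (n : ℝ) μ) :
    VolumicScalar.VolScalGE n ((n : ℝ) * κ) μ := by
  have : SecondCountableTopology X := UniformSpace.secondCountable_of_separable X
  have hn0 : (0 : ℝ) < n := by positivity
  rcases hκ.eq_or_lt with rfl | hκ'
  · exact Or.inl ⟨by simp, 1, one_pos, fun ε hε _ x => hCD.measure_closedBall_le hn hκ hdim x hε⟩
  refine Or.inr ⟨by positivity, fun γ hγ => ?_⟩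
  have hγ0 : 0 < γ := (Real.sqrt_nonneg _).trans_lt hγ
  have hδ : 0 < n * κ * γ ^ 2 / 2 - 1 := by
    rw [Real.sqrt_lt' hγ0, div_lt_iff₀ (by positivity)] at hγ
    linarith
  -- `δ > 0` is the gap between `nκ` and `2/γ²`. The radius `√(3δ/κ)` keeps the quartic error
  -- `κε²/6` below `δ/2`; it does not depend on `x` or `y`.
  set δ := n * κ * γ ^ 2 / 2 - 1 with hδdef
  refine ⟨min γ (√(3 * δ / κ)), lt_min hγ0 (Real.sqrt_pos.2 (by positivity)),
    fun ε hε hεr x y => ?_⟩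
  have hεγ : ε ≤ γ := hεr.trans (min_le_left _ _)
  have hεδ : κ * ε ^ 2 ≤ 3 * δ := by
    have h := pow_le_pow_left₀ hε.le (hεr.trans (min_le_right _ _)) 2
    rw [Real.sq_sqrt (by positivity), le_div_iff₀ hκ'] at h
    linarith
  refine lt_of_lt_of_le ?_ (VolumicScalar.volSE_ballSE_ge_mul hn hγ0 hε hεγ y)
  have hup := hCD.mul_measure_closedBall_le hn hκ hdim x hε
  have hpos : 0 < 1 + κ * ε ^ 2 / 6 := by positivity
  have hpos' : ENNReal.ofReal (1 + κ * ε ^ 2 / 6) ≠ 0 := (ENNReal.ofReal_pos.2 hpos).ne'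
  refine (ENNReal.mul_lt_mul_iff_right hpos' ENNReal.ofReal_ne_top).1 (hup.trans_lt ?_)
  rw [← mul_assoc, ← ENNReal.ofReal_mul hpos.le]
  refine (ENNReal.mul_lt_mul_iff_left (VolumicScalar.euclideanBallVol_pos hε).ne'
    VolumicScalar.euclideanBallVol_lt_top.ne).2 ?_
  have hlt : 1 + κ * ε ^ 2 / (3 * (n + 2))
      < (1 + κ * ε ^ 2 / 6) * (1 - ε ^ 2 / (3 * γ ^ 2 * (n + 2))) := by
    have h1 : (1 + κ * ε ^ 2 / 6) * (1 - ε ^ 2 / (3 * γ ^ 2 * (n + 2)))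
        - (1 + κ * ε ^ 2 / (3 * (n + 2)))
        = ε ^ 2 / (3 * γ ^ 2 * (n + 2)) * (δ - κ * ε ^ 2 / 6) := by
      rw [hδdef]
      field_simp
      ring
    have h2 : 0 < ε ^ 2 / (3 * γ ^ 2 * (n + 2)) * (δ - κ * ε ^ 2 / 6) :=
      mul_pos (by positivity) (by linarith)
    linarith
  exact (ENNReal.ofReal_lt_ofReal_iff (lt_trans (by positivity) hlt)).2 hlt
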